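/- **Setting.** Let $\mathcal X,\mathcal Y$ be measurable spaces and $\mu$ a $\sigma$-finite measure on $\mathcal Y$. A *channel* is a Markov kernel $W$ from $\mathcal X$ to $\mathcal Y$ that is absolutely continuous with respect to $\mu$, with jointly measurable density $W(y\mid x)$. Let $n\ge 0$, and let $\mathcal W_1,\dots,\mathcal W_n$ be sets of channels. A *sequentially interactive protocol* $\Pi$ using $(\mathcal W_1,\dots,\mathcal W_n)$ consists of mutually independent random variables $U$ (public randomness) and $U_1,\dots,U_n$ (private randomness), independent of the inputs $X_1,\dots,X_n$, and of a (measurable) choice, for every round $t$, of a channel $W_t=W_t^{U,U_t,Y_1,\dots,Y_{t-1}}\in\mathcal W_t$ as a function of $U$, $U_t$ and the previous messages; in round $t$ the message $Y_t$ is drawn from $W_t(\cdot\mid X_t)$. The messages $Y^n=(Y_1,\dots,Y_n)$ together with $U$ form the transcript $(Y^n,U)$. Let $k\ge 1$, $\mathcal Z=\{-1,+1\}^k$, and let $z^{\oplus i}$ denote $z\in\mathcal Z$ with the sign of its $i$-th coordinate flipped. Let $(p_z)_{z\in\mathcal Z}$ be probability measures on $\mathcal X$ such that for all $z\in\mathcal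 Z$ and $i\in\{1,\dots,k\}$ we have $p_{z^{\oplus i}}\ll p_z$ and $$\frac{dp_{z^{\oplus i}}}{dp_z}=1+\alpha_{z,i}\,\phi_{z,i}\quad p_z\text{-almost everywhere},$$ where $\phi_{z,i}\colon\mathcal X\to\mathbb R$ is measurable, $\alpha_{z,i}\in\mathbb R$ and $|\alpha_{z,i}|\le\alpha$ for a constant $\alpha\in\mathbb R$ independent of $z$ and $i$. **Theorem (Information contraction bound: the technical form).** Fix $\tau\in(0,1/2]$ and let $Z=(Z_1,\dots,Z_k)$ have independent coordinates in $\{-1,+1\}$ with $\Pr[Z_i=+1]=\tau$ for all $i$. Let $(Y^n,U)$ be the transcript of a sequentially interactive protocol $\Pi$ using $(\mathcal W_1,\dots,\mathcal W_n)$ when the inputs $X_1,\dots,X_n$ are i.i.d. with common distribution $p_Z$. Let $p_z^{Y^n}$ be the law of $Y^n$ when the inputs are i.i.d. from $p_z$, and let $p_{+i}^{Y^n}=\mathbb E[p_Z^{Y^n}\mid Z_i=+1]$ and $p_{-i}^{Y^n}=\mathbb E[p_Z^{Y^n}\mid Z_i=-1]$. Then $$\Big(\frac1k\sum_{i=1}^k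 d_{\mathrm{TV}}\big(p_{+i}^{Y^n},p_{-i}^{Y^n}\big)\Big)^2\le\frac7k\,\alpha^2\sum_{t=1}^n\max_{z\in\mathcal Z}\,\sup_{W\in\mathcal W_t}\,\sum_{i=1}^k\int_{\mathcal Y}\frac{\mathbb E_{X\sim p_z}[\phi_{z,i}(X)W(y\mid X)]^2}{\mathbb E_{X\sim p_z}[W(y\mid X)]}\,d\mu(y),$$ where $d_{\mathrm{TV}}(P,Q)=\sup_A|P(A)-Q(A)|$, the right-hand side takes values in $[0,\infty]$, and $0/0=0\cdot\infty=0$. The same bound holds with the laws of $Y^n$ replaced by the laws of the full transcript $(Y^n,U)$ (with the mixtures defined in the same way). -/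

import Mathlib

open MeasureTheory ProbabilityTheory
open scoped NNReal ENNReal

noncomputable section

/-- Total variation distance `sup_A |P(A) - Q(A)|`, over measurable `A`, of two finite measures. -/
def tvDist {Ω : Type*} [MeasurableSpace Ω] (P Q : Measure Ω) : ℝ :=
  ⨆ A : {A : Set Ω // MeasurableSet A}, |P.real A.1 - Q.real A.1|

instance : MeasurableSingletonClass ℤˣ where
  measurableSet_singleton a :=
    ⟨{(a : ℤ)}, MeasurableSet.singleton _, by ext b; simp [Units.ext_iff]⟩

/-- The law `Rad(τ)` on `{-1, +1}` that gives mass `τ` to `+1` and mass `1 - τ` to `-1`. -/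
def rademacher (τ : ℝ) : Measure ℤˣ :=
  ENNReal.ofReal τ • Measure.dirac 1 + ENNReal.ofReal (1 - τ) • Measure.dirac (-1)

/-- The vector `z^{⊕ i}`: the sign of the `i`-th coordinate of `z` is flipped. -/
def flipCoord {k : ℕ} (z : Fin k → ℤˣ) (i : Fin k) : Fin k → ℤˣ :=
  Function.update z i (-z i)

/-- For `Z ∼ Rad(τ)^{⊗ k}` and laws `Q z` indexed by `z ∈ {-1, +1}^k`, the mixture
`E[Q Z | Z i = s]`. -/
def condMixture {k : ℕ} {Ω : Type*} [MeasurableSpace Ω] (τ : ℝ) (Q : (Fin k → ℤˣ) → Measure Ω)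
    (i : Fin k) (s : ℤˣ) : Measure Ω :=
  ∑ z : Fin k → ℤˣ, (cond (Measure.pi fun _ : Fin k => rademacher τ) {z' | z' i = s}) {z} • Q z

/-- A channel from `X` to `Y`: a Markov kernel that is absolutely continuous with respect to the
reference measure `μ` on `Y`, given through its (jointly measurable) density
`density x y = W(y | x)`. -/
structure Channel (X Y : Type*) [MeasurableSpace X] [MeasurableSpace Y] (μ : Measure Y) where
  density : X → Y → ℝ≥0
  measurable_density : Measurable (Function.uncurry density)
  lintegral_density : ∀ x, ∫⁻ y, (density x y : ℝ≥0∞) ∂μ = 1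

/-- For an input law `P` on `X`, a function `f` on `X` and a channel `W`, the quantity
`∫_Y E_P[f(X) W(y | X)]² / E_P[W(y | X)] dμ(y)`, as an extended nonnegative number. -/
def Channel.info {X Y : Type*} [MeasurableSpace X] [MeasurableSpace Y] {μ : Measure Y}
    (W : Channel X Y μ) (P : Measure X) (f : X → ℝ) : ℝ≥0∞ :=
  ∫⁻ y, ENNReal.ofReal ((∫ x, f x * (W.density x y : ℝ) ∂P) ^ 2) /
    (∫⁻ x, (W.density x y : ℝ≥0∞) ∂P) ∂μ

/-- A sequentially interactive protocol with `n` players using the channel families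
`𝒲 0, …, 𝒲 (n - 1)`. The public randomness takes values in `U` and has law `pubLaw`; the private
randomness of player `t` takes values in `V t` and has law `privLaw t`. From the public randomness
`u`, its private randomness `v` and the previous messages `h`, player `t` obtains the channel
`select t u v h ∈ 𝒲 t`, through which it passes its sample. -/
structure SeqProtocol {X Y : Type*} [MeasurableSpace X] [MeasurableSpace Y] {μ : Measure Y}
    {n : ℕ} (𝒲 : Fin n → Set (Channel X Y μ)) (U : Type*) [MeasurableSpace U]
    (V : Fin n → Type*) [∀ t, MeasurableSpace (V t)] where
  pubLaw : Measure U
  privLaw : ∀ t, Measure (V t)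
  isProbabilityMeasure_pubLaw : IsProbabilityMeasure pubLaw
  isProbabilityMeasure_privLaw : ∀ t, IsProbabilityMeasure (privLaw t)
  select : ∀ t : Fin n, U → V t → (Fin t → Y) → Channel X Y μ
  select_mem : ∀ t u v h, select t u v h ∈ 𝒲 t
  measurable_select : ∀ t : Fin n, Measurable fun q : U × V t × (Fin t → Y) × X × Y =>
    (select t q.1 q.2.1 q.2.2.1).density q.2.2.2.1 q.2.2.2.2

namespace SeqProtocol

variable {X Y : Type*} [MeasurableSpace X] [MeasurableSpace Y] {μ : Measure Y}
  {n : ℕ} {𝒲 : Fin n → Set (Channel X Y μ)} {U : Type*} [MeasurableSpace U]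
  {V : Fin n → Type*} [∀ t, MeasurableSpace (V t)]

/-- The conditional density, with respect to `μ^{⊗ n}`, of the messages `y` given the public
randomness `u`, the private randomness `v` and the samples `x`:
message `y t` has density `W_t(· | x t, y 0, …, y (t - 1))` given the previous ones. -/
def condDensity (Pr : SeqProtocol 𝒲 U V) (u : U) (v : ∀ t, V t) (x : Fin n → X) (y : Fin n → Y) :
    ℝ≥0∞ :=
  ∏ t : Fin n,
    ((Pr.select t u (v t) fun s => y (Fin.castLE t.isLt.le s)).density (x t) (y t) : ℝ≥0∞)

/-- The joint law of the public randomness, the private randomness, the samples and the messages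
when the samples are i.i.d. with law `P`; public randomness, private randomness and samples are
mutually independent. -/
def jointLaw (Pr : SeqProtocol 𝒲 U V) (P : Measure X) :
    Measure (U × (∀ t, V t) × (Fin n → X) × (Fin n → Y)) :=
  (Pr.pubLaw.prod ((Measure.pi Pr.privLaw).prod
      ((Measure.pi fun _ : Fin n => P).prod (Measure.pi fun _ : Fin n => μ)))).withDensity
    fun q => Pr.condDensity q.1 q.2.1 q.2.2.1 q.2.2.2

/-- The law of the transcript `(Y^n, U)` when the samples are i.i.d. with law `P`. -/
def transcriptLaw (Pr : SeqProtocol 𝒲 U V) (P : Measure X) : Measure ((Fin n → Y) × U) :=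
  (Pr.jointLaw P).map fun q => (q.2.2.2, q.1)

/-- The law of the messages `Y^n` when the samples are i.i.d. with law `P`. -/
def messageLaw (Pr : SeqProtocol 𝒲 U V) (P : Measure X) : Measure (Fin n → Y) :=
  (Pr.jointLaw P).map fun q => q.2.2.2

end SeqProtocol

end

-- Fix `z` and compare samples from `P = p z` with samples from `Q i = p (flipCoord z i)`. Given the
-- public and private randomness, the messages have a density that is a product over `t` of
-- conditional densities, so exchanging the factors of `P` for those of `Q i` in any set `S` of
-- rounds leaves a probability density, the hybrid of `S`. For disjoint `A`, `B` the hybrids satisfy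
-- `f_A f_B = f_∅ f_(A ∪ B)` pointwise. Hence the squared `L²` distance `d` of square roots (twice
-- the squared Hellinger distance) has the cut-and-paste property `d A B = d ∅ (A ∪ B)`. Together
-- with Euclidean geometry this gives `d ∅ univ ≤ 4 * ∑ t, d ∅ {t}` (`hybrid_le`), with a constant
-- that does not depend on `n`.
--
-- In `d ∅ {t}` only the factor of round `t` differs, so it is at most the `χ²` divergence of that
-- message, averaged over randomness and history under `P`. As `dQ i / dP = 1 + a i * φ i`, this
-- divergence is at most `α²` times `Channel.info` of the channel in use. The averaging law is that
-- of `P` for every `i`, so the sum over `i` can be taken for one fixed channel, before the supremum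
-- over `𝒲 t`. The private randomness is kept in the sample space so that this channel is a member
-- of `𝒲 t` rather than a mixture of members.
--
-- The squared difference of the masses of any event is at most `d`, which bounds the total
-- variation for every function of randomness and messages, in particular for `Y^n` and for `(Y^n,
-- U)` (`sum_ofReal_tvDist_map_randMsgLaw_sq_le`). Finally, flipping coordinate `i` carries `Z`
-- given `Z_i = +1` to `Z` given `Z_i = -1`, so the mixtures are compared along pairs `z`,
-- `flipCoord z i` (`tvDist_condMixture_le`), and Cauchy–Schwarz over `i` and `z` produces the
-- squared mean.

-- The abstract hybrid inequality for distances with cut-and-paste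

/-- The sum of all squared pairwise distances is at most `2N` times the sum of squared distances
to a fixed point. -/
theorem sum_sum_sub_sq_le {J : Type*} [Fintype J] (x : J → ℝ) (c : ℝ) :
    ∑ j, ∑ l, (x j - x l) ^ 2 ≤ 2 * Fintype.card J * ∑ j, (c - x j) ^ 2 := by
  obtain ⟨w, rfl⟩ : ∃ w : J → ℝ, x = fun j => c - w j := ⟨fun j => c - x j, by simp⟩
  have h1 : ∀ j l, ((c - w j) - (c - w l)) ^ 2 = w j ^ 2 + w l ^ 2 - 2 * (w j * w l) :=
    fun j l => by ring
  simp_rw [h1, sub_sub_cancel, Finset.sum_sub_distrib, Finset.sum_add_distrib, ← Finset.mul_sum,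
    Finset.sum_const, Finset.card_univ, nsmul_eq_mul, ← Finset.mul_sum, ← Finset.sum_mul]
  -- The two sides differ by exactly `2 * (∑ j, w j) ^ 2`.
  nlinarith [sq_nonneg (∑ j, w j)]

/-- The constant `∏ j ∈ {1, …, M}, (1 - 2⁻ʲ)`. -/
noncomputable def hybridConst (M : ℕ) : ℝ := ∏ j ∈ Finset.range M, (1 - (1 / 2 : ℝ) ^ (j + 1))

/-- A plain lower bound `1 / 4` is not inductive, since each new factor is below one; the extra term
`2⁻⁽ᴹ⁺²⁾` absorbs that loss. -/
theorem hybridConst_succ_ge (M : ℕ) :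
    1 / 4 + (1 / 2 : ℝ) ^ (M + 2) ≤ hybridConst (M + 1) := by
  induction M with
  | zero => norm_num [hybridConst]
  | succ M ih =>
    rw [hybridConst, Finset.prod_range_succ, ← hybridConst]
    have e1 : (1 / 2 : ℝ) ^ (M + 2) ≤ 1 / 4 := by
      rw [pow_add]
      nlinarith [pow_le_one₀ (n := M) (by norm_num : (0 : ℝ) ≤ 1 / 2) (by norm_num)]
    have e0 : (0 : ℝ) < (1 / 2 : ℝ) ^ (M + 2) := by positivity
    have e2 : (1 / 2 : ℝ) ^ (M + 1 + 2) = (1 / 2 : ℝ) ^ (M + 2) / 2 := by ring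
    have e3 : (1 / 2 : ℝ) ^ (M + 1 + 1) = (1 / 2 : ℝ) ^ (M + 2) := rfl
    rw [e2, e3]
    nlinarith [mul_le_mul_of_nonneg_right ih (by linarith : (0 : ℝ) ≤ 1 - (1 / 2 : ℝ) ^ (M + 2))]

theorem one_fourth_le_hybridConst (M : ℕ) : 1 / 4 ≤ hybridConst M := by
  cases M with
  | zero => norm_num [hybridConst]
  | succ M =>
    have := hybridConst_succ_ge M
    have h : (0 : ℝ) < (1 / 2 : ℝ) ^ (M + 2) := by positivity
    linarith

/-- Each nonzero `v` in `𝔽₂^(M+1)` splits the index set into pairs `{x, x + v}`. Cut-and-paste turns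
the distance within a pair into that from `∅` to the union, and the unions form a family indexed by
`𝔽₂^M`, to which induction applies. Summing over all `v` recovers all pairwise distances, which
`hpair` controls; the missing `v = 0` accounts for the factor `1 - 2⁻⁽ᴹ⁺¹⁾`. -/
theorem hybridConst_mul_le {ι : Type*} [DecidableEq ι] (d : Finset ι → Finset ι → ℝ)
    (hself : ∀ A, d A A = 0)
    (hcut : ∀ A B, Disjoint A B → d A B = d ∅ (A ∪ B))
    (hpair : ∀ (J : Type) [Fintype J] (A : J → Finset ι),
      ∑ j, ∑ l, d (A j) (A l) ≤ 2 * Fintype.card J * ∑ j, d ∅ (A j))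
    (M : ℕ) : ∀ A : (Fin M → ZMod 2) → Finset ι, (∀ x y, x ≠ y → Disjoint (A x) (A y)) →
      hybridConst M * d ∅ (Finset.univ.biUnion A) ≤ ∑ x, d ∅ (A x) := by
  induction M with
  | zero =>
    intro A _
    simp [hybridConst, Finset.univ_unique]
  | succ M ih =>
    intro A hA
    have key : ∀ v : Fin (M + 1) → ZMod 2, v ≠ 0 →
        2 * hybridConst M * d ∅ (Finset.univ.biUnion A) ≤ ∑ x, d (A x) (A (x + v)) := by
      intro v hv
      obtain ⟨i, hi⟩ : ∃ i, v i = 1 := by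
        obtain ⟨i, hi⟩ := Function.ne_iff.1 hv
        refine ⟨i, ?_⟩
        have : ∀ b : ZMod 2, b ≠ 0 → b = 1 := by decide
        exact this _ hi
      have hvv : v + v = 0 := by
        funext j
        exact CharTwo.add_self_eq_zero _
      have hxv : ∀ x, x ≠ x + v := fun x h => hv (by simpa using h)
      set F : (Fin (M + 1) → ZMod 2) → ℝ := fun x => d ∅ (A x ∪ A (x + v)) with hF
      have hFd : ∀ x, d (A x) (A (x + v)) = F x := fun x => hcut _ _ (hA _ _ (hxv x))
      have hFv : ∀ x, F (x + v) = F x := fun x => by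
        simp only [hF, add_assoc, hvv, add_zero, Finset.union_comm]
      -- As `v i = 1`, exactly one of `x`, `x + v` has `i`-th coordinate `0`; these points represent
      -- the pairs.
      have hins : ∀ w : Fin M → ZMod 2,
          i.insertNth (α := fun _ => ZMod 2) 1 w =
            i.insertNth (α := fun _ => ZMod 2) 0 (w + i.removeNth v) + v := by
        intro w
        funext j
        refine Fin.succAboveCases i ?_ (fun j => ?_) j
        · simp [hi]
        · simp [Fin.removeNth, add_assoc, CharTwo.add_self_eq_zero]
      have hsum : ∑ x, d (A x) (A (x + v)) =
          2 * ∑ w : Fin M → ZMod 2, F (i.insertNth (α := fun _ => ZMod 2) 0 w) := by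
        simp_rw [hFd]
        rw [← (Fin.insertNthEquiv (fun _ => ZMod 2) i).sum_comp, Fintype.sum_prod_type]
        have h2 : (Finset.univ : Finset (ZMod 2)) = {0, 1} := by decide
        rw [h2, Finset.sum_pair (by decide)]
        simp only [Fin.insertNthEquiv, Equiv.coe_fn_mk, hins, hFv]
        have e := Fintype.sum_equiv (Equiv.addRight (i.removeNth v))
          (fun w => F (i.insertNth (α := fun _ => ZMod 2) 0 (w + i.removeNth v)))
          (fun w => F (i.insertNth (α := fun _ => ZMod 2) 0 w)) fun w => rfl
        rw [e, two_mul]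
      -- Merging each pair gives `2 ^ M` sets that are still disjoint and have the same total union.
      have hih := ih (fun w => A (i.insertNth (α := fun _ => ZMod 2) 0 w) ∪
          A (i.insertNth (α := fun _ => ZMod 2) 0 w + v)) (by
        intro w w' hww
        have hne : i.insertNth (α := fun _ => ZMod 2) 0 w ≠
            i.insertNth (α := fun _ => ZMod 2) 0 w' := fun h =>
          hww (Fin.insertNth_injective2 h).2
        have hne' : ∀ w w', i.insertNth (α := fun _ => ZMod 2) 0 w ≠
            i.insertNth (α := fun _ => ZMod 2) 0 w' + v := fun w w' h => by
          have := congrFun h i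
          simp [hi] at this
        simp only [Finset.disjoint_union_left, Finset.disjoint_union_right]
        exact ⟨⟨hA _ _ hne, hA _ _ (hne' _ _).symm⟩, hA _ _ (hne' _ _),
          hA _ _ fun h => hne (add_right_cancel h)⟩)
      have hU : (Finset.univ.biUnion fun w => A (i.insertNth (α := fun _ => ZMod 2) 0 w) ∪
          A (i.insertNth (α := fun _ => ZMod 2) 0 w + v)) = Finset.univ.biUnion A := by
        ext a
        simp only [Finset.mem_biUnion, Finset.mem_univ, true_and, Finset.mem_union]
        constructor
        · rintro ⟨w, h | h⟩ <;> exact ⟨_, h⟩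
        · rintro ⟨x, hx⟩
          have hb : ∀ b : ZMod 2, b = 0 ∨ b = 1 := by decide
          have hx' := Fin.insertNth_self_removeNth i x
          rcases hb (x i) with h | h
          · rw [h] at hx'
            exact ⟨i.removeNth x, Or.inl (by rwa [hx'])⟩
          · rw [h, hins] at hx'
            exact ⟨_, Or.inr (by rwa [hx'])⟩
      rw [hU] at hih
      rw [hsum]
      linarith
    have h1 := hpair _ A
    have h2 : ∑ x, ∑ y, d (A x) (A y) = ∑ v, ∑ x, d (A x) (A (x + v)) := by
      rw [Finset.sum_comm (f := fun v x => d (A x) (A (x + v)))]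
      exact Finset.sum_congr rfl fun x _ =>
        (Fintype.sum_equiv (Equiv.addLeft x) _ _ fun y => rfl).symm
    have hcard : (Fintype.card (Fin (M + 1) → ZMod 2) : ℝ) = 2 ^ (M + 1) := by
      simp [ZMod.card]
    -- There are `2 ^ (M + 1) - 1` nonzero translations; `v = 0` contributes only terms `d (A x) (A
    -- x) = 0`.
    have h3 : ((2 : ℝ) ^ (M + 1) - 1) * (2 * hybridConst M * d ∅ (Finset.univ.biUnion A)) ≤
        ∑ v, ∑ x, d (A x) (A (x + v)) := by
      rw [← Finset.add_sum_erase _ _ (Finset.mem_univ (0 : Fin (M + 1) → ZMod 2))]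
      simp only [add_zero, hself, Finset.sum_const_zero, zero_add]
      refine le_trans (le_of_eq ?_) (Finset.card_nsmul_le_sum _ _ _ fun v hv =>
        key v (Finset.ne_of_mem_erase hv))
      rw [Finset.card_erase_of_mem (Finset.mem_univ _), nsmul_eq_mul, Finset.card_univ,
        Nat.cast_sub Fintype.card_pos, hcard, Nat.cast_one]
    rw [h2, hcard] at h1
    rw [hybridConst, Finset.prod_range_succ, ← hybridConst]
    have hpos : (0 : ℝ) < 2 ^ (M + 1) := by positivity
    have hinv : (1 / 2 : ℝ) ^ (M + 1) * 2 ^ (M + 1) = 1 := by rw [← mul_pow]; norm_num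
    have h4 := h3.trans h1
    refine le_of_mul_le_mul_left ?_ (by positivity : (0 : ℝ) < 2 * 2 ^ (M + 1))
    refine le_trans (le_of_eq ?_) h4
    linear_combination (-2 * hybridConst M * d ∅ (Finset.univ.biUnion A)) * hinv

/-- Hybrid bound: under the cut-and-paste property, the squared distance of `∅` and `univ` is at
most four times the sum of those of `∅` and the singletons. -/
theorem hybrid_le {ι : Type*} [Fintype ι] [DecidableEq ι] (d : Finset ι → Finset ι → ℝ)
    (hself : ∀ A, d A A = 0) (hnn : ∀ A B, 0 ≤ d A B)
    (hcut : ∀ A B, Disjoint A B → d A B = d ∅ (A ∪ B))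
    (hpair : ∀ (J : Type) [Fintype J] (A : J → Finset ι),
      ∑ j, ∑ l, d (A j) (A l) ≤ 2 * Fintype.card J * ∑ j, d ∅ (A j)) :
    d ∅ Finset.univ ≤ 4 * ∑ t, d ∅ {t} := by
  obtain ⟨e⟩ : Nonempty (ι ↪ (Fin (Fintype.card ι) → ZMod 2)) := by
    refine Function.Embedding.nonempty_of_card_le ?_
    simpa [ZMod.card] using Nat.lt_two_pow_self.le
  have h := hybridConst_mul_le d hself hcut hpair (Fintype.card ι)
    (fun x => Finset.univ.filter fun t => e t = x) (by
      intro x y hxy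
      rw [Finset.disjoint_filter]
      rintro t - rfl
      exact hxy)
  have hU : (Finset.univ.biUnion fun x => Finset.univ.filter fun t => e t = x) =
      (Finset.univ : Finset ι) := by
    ext; simp
  -- The fibres of the embedding are singletons or empty, and the empty ones contribute `d ∅ ∅ = 0`.
  have hS : ∑ x, d ∅ (Finset.univ.filter fun t => e t = x) = ∑ t, d ∅ {t} := by
    rw [← Finset.sum_subset (Finset.subset_univ (Finset.univ.map e)), Finset.sum_map]
    · refine Finset.sum_congr rfl fun t _ => ?_
      congr 1
      ext s; simp
    · intro x _ hx
      have : (Finset.univ.filter fun t => e t = x) = ∅ := by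
        ext t
        simp only [Finset.mem_filter, Finset.mem_univ, true_and, Finset.notMem_empty, iff_false]
        rintro rfl
        simp at hx
      rw [this, hself]
  rw [hU, hS] at h
  have := mul_le_mul_of_nonneg_right (one_fourth_le_hybridConst (Fintype.card ι))
    (hnn ∅ Finset.univ)
  linarith

-- Hellinger geometry of hybrid product densities

section Hybrid

variable {Θ ι : Type*} [Fintype ι] [DecidableEq ι]

/-- The product density in which the factors indexed by `S` are taken from `q`, the others
from `f`. -/
def hybridDensity (f q : ι → Θ → ℝ≥0) (S : Finset ι) (θ : Θ) : ℝ≥0 :=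
  ∏ t, if t ∈ S then q t θ else f t θ

/-- The squared `L²` distance of the square roots of two hybrid densities. -/
noncomputable def hybridDist [MeasurableSpace Θ] (ν : Measure Θ) (f q : ι → Θ → ℝ≥0)
    (A B : Finset ι) : ℝ :=
  ∫ θ, (√(hybridDensity f q A θ : ℝ) - √(hybridDensity f q B θ : ℝ)) ^ 2 ∂ν

theorem hybridDist_nonneg [MeasurableSpace Θ] (ν : Measure Θ) (f q : ι → Θ → ℝ≥0)
    (A B : Finset ι) : 0 ≤ hybridDist ν f q A B :=
  integral_nonneg fun _ => sq_nonneg _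

theorem hybridDensity_mul_of_disjoint (f q : ι → Θ → ℝ≥0) {A B : Finset ι} (h : Disjoint A B)
    (θ : Θ) : hybridDensity f q A θ * hybridDensity f q B θ =
      hybridDensity f q ∅ θ * hybridDensity f q (A ∪ B) θ := by
  simp only [hybridDensity, ← Finset.prod_mul_distrib]
  refine Finset.prod_congr rfl fun t _ => ?_
  have := fun ha : t ∈ A => Finset.disjoint_left.1 h ha
  by_cases ha : t ∈ A <;> by_cases hb : t ∈ B <;> simp_all [mul_comm]

theorem hybridDensity_empty_eq (f q : ι → Θ → ℝ≥0) (t : ι) (θ : Θ) :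
    hybridDensity f q ∅ θ = f t θ * ∏ s ∈ Finset.univ.erase t, f s θ := by
  simp [hybridDensity, Finset.mul_prod_erase Finset.univ (fun s => f s θ)]

theorem hybridDensity_singleton_eq (f q : ι → Θ → ℝ≥0) (t : ι) (θ : Θ) :
    hybridDensity f q {t} θ = q t θ * ∏ s ∈ Finset.univ.erase t, f s θ := by
  rw [hybridDensity, ← Finset.mul_prod_erase _ _ (Finset.mem_univ t)]
  congr 1
  · simp
  · exact Finset.prod_congr rfl fun s hs => by simp [Finset.ne_of_mem_erase hs]

/-- From `(b - a)² = (√a - √b)² (√a + √b)²` and `(√a + √b)² ≥ a`. For `a = 0` the right side is `∞`,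
or `0 / 0 = 0` when also `b = 0`. -/
theorem ofReal_sqrt_sub_sqrt_sq_le (a b : ℝ≥0) :
    ENNReal.ofReal ((√(a : ℝ) - √(b : ℝ)) ^ 2) ≤ ENNReal.ofReal (((b : ℝ) - a) ^ 2) / a := by
  rcases eq_or_ne a 0 with rfl | ha
  · rcases eq_or_ne b 0 with rfl | hb
    · simp
    · rw [ENNReal.coe_zero, ENNReal.div_zero]
      · exact le_top
      · simpa [ENNReal.ofReal_eq_zero] using hb
  · have ha' : (0 : ℝ) < a := by exact_mod_cast pos_iff_ne_zero.2 ha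
    rw [ENNReal.le_div_iff_mul_le (by simp [ha]) (by simp), ← ENNReal.ofReal_coe_nnreal,
      ← ENNReal.ofReal_mul (sq_nonneg _)]
    refine ENNReal.ofReal_le_ofReal ?_
    have h1 := Real.sq_sqrt a.coe_nonneg
    have h2 := Real.sq_sqrt b.coe_nonneg
    have h3 := Real.sqrt_nonneg (a : ℝ)
    have h4 := Real.sqrt_nonneg (b : ℝ)
    set x := √(a : ℝ)
    set y := √(b : ℝ)
    rw [← h1, ← h2]
    have : (y ^ 2 - x ^ 2) ^ 2 = (x - y) ^ 2 * (x + y) ^ 2 := by ring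
    rw [this]
    exact mul_le_mul_of_nonneg_left (by nlinarith) (sq_nonneg _)

theorem ofReal_hybrid_singleton_sq_le (f q : ι → Θ → ℝ≥0) (t : ι) (θ : Θ) :
    ENNReal.ofReal ((√(hybridDensity f q ∅ θ : ℝ) - √(hybridDensity f q {t} θ : ℝ)) ^ 2) ≤
      ∏ s, if s = t then ENNReal.ofReal (((q t θ : ℝ) - f t θ) ^ 2) / f t θ
        else (f s θ : ℝ≥0∞) := by
  rw [hybridDensity_empty_eq f q t, hybridDensity_singleton_eq f q t,
    ← Finset.mul_prod_erase _ _ (Finset.mem_univ t), if_pos rfl,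
    Finset.prod_congr rfl (fun s hs => if_neg (Finset.ne_of_mem_erase hs)),
    ← ENNReal.ofNNReal_finsetProd]
  set R : ℝ≥0 := ∏ s ∈ Finset.univ.erase t, f s θ
  rw [NNReal.coe_mul, NNReal.coe_mul, Real.sqrt_mul (NNReal.coe_nonneg _),
    Real.sqrt_mul (NNReal.coe_nonneg _), ← sub_mul, mul_pow, Real.sq_sqrt R.coe_nonneg,
    ENNReal.ofReal_mul (sq_nonneg _), ENNReal.ofReal_coe_nnreal]
  exact mul_le_mul_left (ofReal_sqrt_sub_sqrt_sq_le _ _) _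

theorem sqrt_sub_sqrt_hybridDensity_sq (f q : ι → Θ → ℝ≥0) (A B : Finset ι) (θ : Θ) :
    (√(hybridDensity f q A θ : ℝ) - √(hybridDensity f q B θ : ℝ)) ^ 2 =
      hybridDensity f q A θ + hybridDensity f q B θ -
        2 * (√(hybridDensity f q A θ : ℝ) * √(hybridDensity f q B θ : ℝ)) := by
  rw [sub_sq, Real.sq_sqrt (NNReal.coe_nonneg _), Real.sq_sqrt (NNReal.coe_nonneg _)]
  ring

variable [MeasurableSpace Θ] {ν : Measure Θ} {f q : ι → Θ → ℝ≥0}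

theorem measurable_hybridDensity (hf : ∀ t, Measurable (f t)) (hq : ∀ t, Measurable (q t))
    (S : Finset ι) : Measurable (hybridDensity f q S) := by
  unfold hybridDensity
  refine Finset.measurable_prod _ fun t _ => ?_
  split_ifs
  exacts [hq t, hf t]

theorem integrable_hybridDensity (hf : ∀ t, Measurable (f t)) (hq : ∀ t, Measurable (q t))
    (h1 : ∀ S, ∫⁻ θ, (hybridDensity f q S θ : ℝ≥0∞) ∂ν = 1) (S : Finset ι) :
    Integrable (fun θ => (hybridDensity f q S θ : ℝ)) ν := by
  refine ⟨(measurable_hybridDensity hf hq S).coe_nnreal_real.aestronglyMeasurable, ?_⟩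
  rw [hasFiniteIntegral_iff_enorm]
  simp [h1]

theorem integral_hybridDensity
    (h1 : ∀ S, ∫⁻ θ, (hybridDensity f q S θ : ℝ≥0∞) ∂ν = 1) (hf : ∀ t, Measurable (f t))
    (hq : ∀ t, Measurable (q t)) (S : Finset ι) :
    ∫ θ, (hybridDensity f q S θ : ℝ) ∂ν = 1 := by
  rw [integral_eq_lintegral_of_nonneg_ae (.of_forall fun θ => NNReal.coe_nonneg _)
    (measurable_hybridDensity hf hq S).coe_nnreal_real.aestronglyMeasurable]
  simp [h1]

theorem integrable_sqrt_mul_sqrt_hybridDensity (hf : ∀ t, Measurable (f t))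
    (hq : ∀ t, Measurable (q t)) (h1 : ∀ S, ∫⁻ θ, (hybridDensity f q S θ : ℝ≥0∞) ∂ν = 1)
    (A B : Finset ι) :
    Integrable (fun θ => √(hybridDensity f q A θ : ℝ) * √(hybridDensity f q B θ : ℝ)) ν := by
  refine ((integrable_hybridDensity hf hq h1 A).add (integrable_hybridDensity hf hq h1 B)).mono'
    ?_ (.of_forall fun θ => ?_)
  · exact ((measurable_hybridDensity hf hq A).coe_nnreal_real.sqrt.mul
      (measurable_hybridDensity hf hq B).coe_nnreal_real.sqrt).aestronglyMeasurable
  · rw [Real.norm_of_nonneg (by positivity)]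
    have ha := Real.sq_sqrt (hybridDensity f q A θ).coe_nonneg
    have hb := Real.sq_sqrt (hybridDensity f q B θ).coe_nonneg
    simp only [Pi.add_apply]
    nlinarith [sq_nonneg (√(hybridDensity f q A θ : ℝ) - √(hybridDensity f q B θ : ℝ)),
      sq_nonneg (√(hybridDensity f q A θ : ℝ)), sq_nonneg (√(hybridDensity f q B θ : ℝ))]

theorem integrable_sqrt_sub_sqrt_hybridDensity_sq (hf : ∀ t, Measurable (f t))
    (hq : ∀ t, Measurable (q t)) (h1 : ∀ S, ∫⁻ θ, (hybridDensity f q S θ : ℝ≥0∞) ∂ν = 1)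
    (A B : Finset ι) :
    Integrable (fun θ =>
      (√(hybridDensity f q A θ : ℝ) - √(hybridDensity f q B θ : ℝ)) ^ 2) ν := by
  simp_rw [sqrt_sub_sqrt_hybridDensity_sq]
  exact ((integrable_hybridDensity hf hq h1 A).add (integrable_hybridDensity hf hq h1 B)).sub
    ((integrable_sqrt_mul_sqrt_hybridDensity hf hq h1 A B).const_mul 2)

theorem hybridDist_eq (hf : ∀ t, Measurable (f t))
    (hq : ∀ t, Measurable (q t)) (h1 : ∀ S, ∫⁻ θ, (hybridDensity f q S θ : ℝ≥0∞) ∂ν = 1)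
    (A B : Finset ι) :
    hybridDist ν f q A B =
      2 - 2 * ∫ θ, √(hybridDensity f q A θ : ℝ) * √(hybridDensity f q B θ : ℝ) ∂ν := by
  unfold hybridDist
  simp_rw [sqrt_sub_sqrt_hybridDensity_sq]
  rw [integral_sub, integral_add, integral_const_mul, integral_hybridDensity h1 hf hq,
    integral_hybridDensity h1 hf hq]
  · norm_num
  · exact integrable_hybridDensity hf hq h1 A
  · exact integrable_hybridDensity hf hq h1 B
  · exact (integrable_hybridDensity hf hq h1 A).add (integrable_hybridDensity hf hq h1 B)
  · exact (integrable_sqrt_mul_sqrt_hybridDensity hf hq h1 A B).const_mul 2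

/-- All hybrids have mass one, so their distance depends only on the integral of `√(f_A f_B)`, and
the product identity for disjoint sets gives cut-and-paste. The pairwise bound holds pointwise in
`θ` and is integrated. -/
theorem hybridDist_univ_le (hf : ∀ t, Measurable (f t))
    (hq : ∀ t, Measurable (q t)) (h1 : ∀ S, ∫⁻ θ, (hybridDensity f q S θ : ℝ≥0∞) ∂ν = 1) :
    hybridDist ν f q ∅ Finset.univ ≤ 4 * ∑ t, hybridDist ν f q ∅ {t} := by
  refine hybrid_le _ (fun A => by simp [hybridDist])
    (hybridDist_nonneg ν f q) (fun A B hAB => ?_) (fun J _ A => ?_)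
  · rw [hybridDist_eq hf hq h1, hybridDist_eq hf hq h1]
    simp_rw [← Real.sqrt_mul (NNReal.coe_nonneg _), ← NNReal.coe_mul,
      hybridDensity_mul_of_disjoint f q hAB]
  · have hi := integrable_sqrt_sub_sqrt_hybridDensity_sq hf hq h1
    unfold hybridDist
    simp_rw [← integral_finsetSum _ fun l _ => hi _ (A l)]
    rw [← integral_finsetSum _ fun j _ => integrable_finsetSum _ fun l _ => hi (A j) (A l),
      ← integral_const_mul]
    refine integral_mono
      (integrable_finsetSum _ fun j _ => integrable_finsetSum _ fun l _ => hi (A j) (A l))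
      ((integrable_finsetSum _ fun j _ => hi ∅ (A j)).const_mul _) fun θ => ?_
    exact sum_sum_sub_sq_le (fun j => √(hybridDensity f q (A j) θ : ℝ)) _

theorem ofReal_hybridDist_singleton_le (hf : ∀ t, Measurable (f t))
    (hq : ∀ t, Measurable (q t)) (h1 : ∀ S, ∫⁻ θ, (hybridDensity f q S θ : ℝ≥0∞) ∂ν = 1)
    (t : ι) :
    ENNReal.ofReal (hybridDist ν f q ∅ {t}) ≤
      ∫⁻ θ, ∏ s, if s = t then ENNReal.ofReal (((q t θ : ℝ) - f t θ) ^ 2) / f t θ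
        else (f s θ : ℝ≥0∞) ∂ν := by
  rw [hybridDist, ofReal_integral_eq_lintegral_ofReal
    (integrable_sqrt_sub_sqrt_hybridDensity_sq hf hq h1 _ _) (.of_forall fun θ => sq_nonneg _)]
  exact lintegral_mono fun θ => ofReal_hybrid_singleton_sq_le f q t θ

/-- The squared difference of the masses of a set is at most the squared `L²` distance of the
square roots of the densities. -/
theorem setIntegral_hybridDensity_sub_sq_le (hf : ∀ t, Measurable (f t))
    (hq : ∀ t, Measurable (q t)) (h1 : ∀ S, ∫⁻ θ, (hybridDensity f q S θ : ℝ≥0∞) ∂ν = 1)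
    (A B : Finset ι) {E : Set Θ} (hE : MeasurableSet E) :
    (∫ θ in E, (hybridDensity f q A θ : ℝ) ∂ν - ∫ θ in E, (hybridDensity f q B θ : ℝ) ∂ν) ^ 2 ≤
      hybridDist ν f q A B := by
  have iA := integrable_hybridDensity hf hq h1 A
  have iB := integrable_hybridDensity hf hq h1 B
  have iD := integrable_sqrt_sub_sqrt_hybridDensity_sq hf hq h1 A B
  rw [← integral_sub iA.integrableOn iB.integrableOn]
  have iAB : Integrable (fun θ => (hybridDensity f q A θ : ℝ) + hybridDensity f q B θ) ν :=
    iA.add iB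
  set g : Θ → ℝ := fun θ => (hybridDensity f q A θ : ℝ) - hybridDensity f q B θ with hg
  have ig : Integrable g ν := iA.sub iB
  set I := ∫ θ in E, g θ ∂ν with hI
  have h0 : ∫ θ, g θ ∂ν = 0 := by
    rw [hg, integral_sub iA iB, integral_hybridDensity h1 hf hq, integral_hybridDensity h1 hf hq,
      sub_self]
  -- Since `g` has integral zero, `E` and its complement each contribute at least `|I|`.
  have h2 : 2 * |I| ≤ ∫ θ, |g θ| ∂ν := by
    have e1 := integral_add_compl hE ig
    have e2 := integral_add_compl hE ig.abs
    have e3 : |I| ≤ ∫ θ in E, |g θ| ∂ν := abs_integral_le_integral_abs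
    have e4 : |∫ θ in Eᶜ, g θ ∂ν| ≤ ∫ θ in Eᶜ, |g θ| ∂ν := abs_integral_le_integral_abs
    have e5 : ∫ θ in Eᶜ, g θ ∂ν = -I := by linarith
    rw [e5, abs_neg] at e4
    linarith
  -- With `a`, `b` the square roots of the densities, AM–GM gives `|I| |a - b| (a + b) ≤ (a - b)² +
  -- I² (a + b)² / 4 ≤ (a - b)² + I² (a² + b²) / 2`, and `a² + b²` has integral two. Combined with
  -- `h2` this yields `2 I² ≤ d + I²`.
  have h3 : |I| * ∫ θ, |g θ| ∂ν ≤ hybridDist ν f q A B + I ^ 2 := by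
    have : hybridDist ν f q A B + I ^ 2 =
        ∫ θ, ((√(hybridDensity f q A θ : ℝ) - √(hybridDensity f q B θ : ℝ)) ^ 2 +
          I ^ 2 / 2 * ((hybridDensity f q A θ : ℝ) + hybridDensity f q B θ)) ∂ν := by
      rw [integral_add iD (iAB.const_mul _), integral_const_mul, integral_add iA iB,
        integral_hybridDensity h1 hf hq, integral_hybridDensity h1 hf hq, hybridDist]
      ring
    rw [this, ← integral_const_mul]
    refine integral_mono (ig.abs.const_mul _) (iD.add (iAB.const_mul _)) fun θ => ?_
    have ha := Real.sq_sqrt (hybridDensity f q A θ).coe_nonneg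
    have hb := Real.sq_sqrt (hybridDensity f q B θ).coe_nonneg
    have ha' := Real.sqrt_nonneg (hybridDensity f q A θ : ℝ)
    have hb' := Real.sqrt_nonneg (hybridDensity f q B θ : ℝ)
    simp only [hg]
    set a := √(hybridDensity f q A θ : ℝ)
    set b := √(hybridDensity f q B θ : ℝ)
    rw [← ha, ← hb]
    have e : |a ^ 2 - b ^ 2| = |a - b| * (a + b) := by
      rw [sq_sub_sq, abs_mul, abs_of_nonneg (by positivity : 0 ≤ a + b), mul_comm]
    rw [e, ← sq_abs (a - b), ← sq_abs I]
    nlinarith [sq_nonneg (|a - b| - |I| * (a + b) / 2), mul_nonneg (sq_nonneg |I|)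
      (sq_nonneg (a - b))]
  have h4 := mul_le_mul_of_nonneg_left h2 (abs_nonneg I)
  nlinarith [sq_abs I]

/-- The squared difference of the masses that two product densities give to a set is bounded by
four times the sum over the factors of the `χ²`-type divergences. -/
theorem ofReal_withDensity_sub_sq_le (hf : ∀ t, Measurable (f t))
    (hq : ∀ t, Measurable (q t)) (h1 : ∀ S, ∫⁻ θ, (hybridDensity f q S θ : ℝ≥0∞) ∂ν = 1)
    {E : Set Θ} (hE : MeasurableSet E) :
    ENNReal.ofReal (((ν.withDensity fun θ => ∏ t, (f t θ : ℝ≥0∞)).real E -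
        (ν.withDensity fun θ => ∏ t, (q t θ : ℝ≥0∞)).real E) ^ 2) ≤
      4 * ∑ t, ∫⁻ θ, ∏ s, if s = t then ENNReal.ofReal (((q t θ : ℝ) - f t θ) ^ 2) / f t θ
        else (f s θ : ℝ≥0∞) ∂ν := by
  have hreal : ∀ S, (ν.withDensity fun θ => (hybridDensity f q S θ : ℝ≥0∞)).real E =
      ∫ θ in E, (hybridDensity f q S θ : ℝ) ∂ν := by
    intro S
    rw [integral_eq_lintegral_of_nonneg_ae (.of_forall fun θ => NNReal.coe_nonneg _)
      (measurable_hybridDensity hf hq S).coe_nnreal_real.aestronglyMeasurable,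
      Measure.real, withDensity_apply _ hE]
    simp
  have e1 : (fun θ => ∏ t, (f t θ : ℝ≥0∞)) = fun θ => (hybridDensity f q ∅ θ : ℝ≥0∞) := by
    funext θ; simp [hybridDensity]
  have e2 : (fun θ => ∏ t, (q t θ : ℝ≥0∞)) =
      fun θ => (hybridDensity f q Finset.univ θ : ℝ≥0∞) := by
    funext θ; simp [hybridDensity]
  rw [e1, e2, hreal, hreal]
  refine (ENNReal.ofReal_le_ofReal ((setIntegral_hybridDensity_sub_sq_le hf hq h1 _ _ hE).trans
    (hybridDist_univ_le hf hq h1))).trans ?_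
  rw [ENNReal.ofReal_mul (by norm_num), ENNReal.ofReal_ofNat,
    ENNReal.ofReal_sum_of_nonneg fun t _ => hybridDist_nonneg ν f q ∅ {t}]
  gcongr with t
  exact ofReal_hybridDist_singleton_le hf hq h1 t

end Hybrid

-- Integrals of products whose factors depend on the history

section SequentialProduct

variable {Y : Type*} [MeasurableSpace Y]

/-- The entries of `y` before `t`. -/
def history {n : ℕ} {Y : Type*} (t : Fin n) (y : Fin n → Y) : Fin t → Y :=
  fun s => y (Fin.castLE t.isLt.le s)

theorem measurable_history {n : ℕ} (t : Fin n) : Measurable (history (Y := Y) t) :=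
  measurable_pi_lambda _ fun _ => measurable_pi_apply _

theorem measurable_prod_history {n : ℕ} {g : ∀ t : Fin n, (Fin t → Y) → Y → ℝ≥0∞}
    (hg : ∀ t, Measurable (Function.uncurry (g t))) :
    Measurable fun y : Fin n → Y => ∏ t, g t (history t y) (y t) :=
  Finset.measurable_prod _ fun t _ =>
    (hg t).comp ((measurable_history t).prodMk (measurable_pi_apply t))

variable {μ : Measure Y} [SigmaFinite μ]

/-- Integrating the last factor of a sequential product first. -/
theorem lintegral_prod_history_succ {n : ℕ}
    {g : ∀ t : Fin (n + 1), (Fin t → Y) → Y → ℝ≥0∞}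
    (hg : ∀ t, Measurable (Function.uncurry (g t))) :
    ∫⁻ y, ∏ t, g t (history t y) (y t) ∂(Measure.pi fun _ => μ) =
      ∫⁻ y : Fin n → Y, (∏ t : Fin n, g t.castSucc (history t y) (y t)) *
        ∫⁻ b, g (Fin.last n) y b ∂μ ∂(Measure.pi fun _ => μ) := by
  have e := (measurePreserving_piFinSuccAbove (fun _ : Fin (n + 1) => μ) (Fin.last n)).symm
  rw [← e.lintegral_comp (measurable_prod_history hg)]
  refine (lintegral_prod_symm' _ ((measurable_prod_history hg).comp e.measurable)).trans ?_
  refine lintegral_congr fun y => ?_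
  have hl : Measurable fun b => g (Fin.last n) y b :=
    (hg (Fin.last n)).comp measurable_prodMk_left
  refine Eq.trans (lintegral_congr fun b => ?_) (lintegral_const_mul _ hl)
  rw [Function.comp_apply, Fin.prod_univ_castSucc]
  have hz : (MeasurableEquiv.piFinSuccAbove (fun _ => Y) (Fin.last n)).symm (b, y) =
      Fin.snoc (α := fun _ => Y) y b := Fin.insertNth_last' b y
  rw [hz]
  congr 1
  · refine Finset.prod_congr rfl fun t _ => ?_
    rw [Fin.snoc_castSucc]
    congr 1
    funext s
    exact Fin.snoc_castSucc (α := fun _ => Y) b y (Fin.castLE t.isLt.le s)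
  · rw [Fin.snoc_last]
    congr 1
    funext s
    exact Fin.snoc_castSucc (α := fun _ => Y) b y s

theorem lintegral_prod_history_le {n : ℕ} {g : ∀ t : Fin n, (Fin t → Y) → Y → ℝ≥0∞}
    (hg : ∀ t, Measurable (Function.uncurry (g t))) {C : Fin n → ℝ≥0∞}
    (hC : ∀ t h, ∫⁻ b, g t h b ∂μ ≤ C t) :
    ∫⁻ y, ∏ t, g t (history t y) (y t) ∂(Measure.pi fun _ => μ) ≤ ∏ t, C t := by
  induction n with
  | zero => simp
  | succ n ih =>
    rw [lintegral_prod_history_succ hg, Fin.prod_univ_castSucc]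
    have h : ∫⁻ y : Fin n → Y, (∏ t : Fin n, g t.castSucc (history t y) (y t)) *
        ∫⁻ b, g (Fin.last n) y b ∂μ ∂(Measure.pi fun _ => μ) ≤
        ∫⁻ y : Fin n → Y, (∏ t : Fin n, g t.castSucc (history t y) (y t)) * C (Fin.last n)
          ∂(Measure.pi fun _ => μ) := 
      lintegral_mono fun y => mul_le_mul_right (hC (Fin.last n) y) _
    refine h.trans ?_
    rw [lintegral_mul_const _
      (measurable_prod_history (g := fun t : Fin n => g t.castSucc) fun t => hg t.castSucc)]
    exact mul_le_mul_left
      (ih (g := fun t => g t.castSucc) (fun t => hg t.castSucc) fun t => hC t.castSucc) _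

theorem lintegral_prod_history_eq {n : ℕ} {g : ∀ t : Fin n, (Fin t → Y) → Y → ℝ≥0∞}
    (hg : ∀ t, Measurable (Function.uncurry (g t))) {C : Fin n → ℝ≥0∞}
    (hC : ∀ t h, ∫⁻ b, g t h b ∂μ = C t) :
    ∫⁻ y, ∏ t, g t (history t y) (y t) ∂(Measure.pi fun _ => μ) = ∏ t, C t := by
  induction n with
  | zero => simp
  | succ n ih =>
    rw [lintegral_prod_history_succ hg, Fin.prod_univ_castSucc]
    have h : ∫⁻ y : Fin n → Y, (∏ t : Fin n, g t.castSucc (history t y) (y t)) *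
        ∫⁻ b, g (Fin.last n) y b ∂μ ∂(Measure.pi fun _ => μ) =
        ∫⁻ y : Fin n → Y, (∏ t : Fin n, g t.castSucc (history t y) (y t)) * C (Fin.last n)
          ∂(Measure.pi fun _ => μ) := 
      lintegral_congr fun y => congrArg _ (hC (Fin.last n) y)
    refine h.trans ?_
    rw [lintegral_mul_const _
      (measurable_prod_history (g := fun t : Fin n => g t.castSucc) fun t => hg t.castSucc)]
    exact congrArg (· * _)
      (ih (g := fun t => g t.castSucc) (fun t => hg t.castSucc) fun t => hC t.castSucc)

theorem lintegral_pi_prod_eq {n : ℕ} {f : Fin n → Y → ℝ≥0∞} (hf : ∀ t, Measurable (f t)) :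
    ∫⁻ y, ∏ t, f t (y t) ∂(Measure.pi fun _ => μ) = ∏ t, ∫⁻ b, f t b ∂μ :=
  lintegral_prod_history_eq (g := fun t _ => f t) (fun t => (hf t).comp measurable_snd)
    fun _ _ => rfl

end SequentialProduct

-- Output densities of a single channel

namespace Channel

variable {X Y : Type*} [MeasurableSpace X] [MeasurableSpace Y] {μ : Measure Y}

/-- The density of the output of the channel `W` when its input has law `P`. -/
noncomputable def outDensity (W : Channel X Y μ) (P : Measure X) (y : Y) : ℝ≥0∞ :=
  ∫⁻ x, (W.density x y : ℝ≥0∞) ∂P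

theorem measurable_outDensity (W : Channel X Y μ) (P : Measure X) [SFinite P] :
    Measurable (W.outDensity P) :=
  W.measurable_density.coe_nnreal_ennreal.lintegral_prod_left'

theorem lintegral_outDensity [SFinite μ] (W : Channel X Y μ) (P : Measure X)
    [IsProbabilityMeasure P] : ∫⁻ y, W.outDensity P y ∂μ = 1 := by
  unfold outDensity
  rw [← lintegral_lintegral_swap W.measurable_density.coe_nnreal_ennreal.aemeasurable]
  simp [W.lintegral_density]

theorem ae_outDensity_lt_top [SFinite μ] (W : Channel X Y μ) (P : Measure X)
    [IsProbabilityMeasure P] : ∀ᵐ y ∂μ, W.outDensity P y < ∞ :=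
  ae_lt_top (W.measurable_outDensity P) (by simp [lintegral_outDensity])

theorem lintegral_toNNReal_outDensity [SFinite μ] (W : Channel X Y μ) (P : Measure X)
    [IsProbabilityMeasure P] : ∫⁻ y, ((W.outDensity P y).toNNReal : ℝ≥0∞) ∂μ = 1 := by
  rw [← W.lintegral_outDensity P]
  refine lintegral_congr_ae ?_
  filter_upwards [W.ae_outDensity_lt_top P] with y hy
  exact ENNReal.coe_toNNReal hy.ne

theorem measurable_density_left (W : Channel X Y μ) (y : Y) :
    Measurable fun x => W.density x y :=
  W.measurable_density.comp measurable_prodMk_right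

theorem integrable_density (W : Channel X Y μ) (P : Measure X) {y : Y}
    (hy : W.outDensity P y < ∞) : Integrable (fun x => (W.density x y : ℝ)) P := by
  refine ⟨(W.measurable_density_left y).coe_nnreal_real.aestronglyMeasurable, ?_⟩
  rw [hasFiniteIntegral_iff_enorm]
  simpa [outDensity] using hy

theorem integral_density (W : Channel X Y μ) (P : Measure X) (y : Y) :
    ∫ x, (W.density x y : ℝ) ∂P = (W.outDensity P y).toReal := by
  rw [integral_eq_lintegral_of_nonneg_ae (.of_forall fun x => NNReal.coe_nonneg _)
    (W.measurable_density_left y).coe_nnreal_real.aestronglyMeasurable]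
  simp [outDensity]

/-- If `dQ/dP = 1 + a φ`, the output densities of a channel differ by `a E_P[φ(X) W(y | X)]`. -/
theorem toReal_outDensity_sub (W : Channel X Y μ) {P Q : Measure X} [IsProbabilityMeasure P]
    [IsProbabilityMeasure Q] (hQP : Q ≪ P) {a : ℝ} {φ : X → ℝ}
    (hdens : (fun x => (Q.rnDeriv P x).toReal) =ᵐ[P] fun x => 1 + a * φ x) {y : Y}
    (hP : W.outDensity P y < ∞) (hQ : W.outDensity Q y < ∞) :
    (W.outDensity Q y).toReal - (W.outDensity P y).toReal =
      a * ∫ x, φ x * (W.density x y : ℝ) ∂P := by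
  have iP := W.integrable_density P hP
  have iQ := (integrable_rnDeriv_smul_iff hQP).2 (W.integrable_density Q hQ)
  rw [← integral_density, ← integral_density, ← integral_rnDeriv_smul hQP, ← integral_sub iQ iP,
    ← integral_const_mul]
  refine integral_congr_ae ?_
  filter_upwards [hdens] with x hx
  rw [hx, smul_eq_mul]
  ring

/-- This is the `χ²` divergence of the outputs. Output densities may be infinite on a `μ`-null set;
off it, the integrands agree once `a²` is pulled out. -/
theorem lintegral_outDensity_sub_sq_div_le [SFinite μ] (W : Channel X Y μ) {P Q : Measure X}
    [IsProbabilityMeasure P] [IsProbabilityMeasure Q] (hQP : Q ≪ P) {a : ℝ} {φ : X → ℝ}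
    (hdens : (fun x => (Q.rnDeriv P x).toReal) =ᵐ[P] fun x => 1 + a * φ x) :
    ∫⁻ y, ENNReal.ofReal ((((W.outDensity Q y).toNNReal : ℝ) - (W.outDensity P y).toNNReal) ^ 2) /
      ((W.outDensity P y).toNNReal : ℝ≥0∞) ∂μ ≤ ENNReal.ofReal (a ^ 2) * W.info P φ := by
  rw [info, ← lintegral_const_mul' _ _ ENNReal.ofReal_ne_top]
  refine lintegral_mono_ae ?_
  filter_upwards [W.ae_outDensity_lt_top P, W.ae_outDensity_lt_top Q] with y hP hQ
  rw [ENNReal.coe_toNNReal_eq_toReal, ENNReal.coe_toNNReal_eq_toReal,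
    W.toReal_outDensity_sub hQP hdens hP hQ, ENNReal.coe_toNNReal hP.ne, mul_pow,
    ENNReal.ofReal_mul (sq_nonneg a), mul_div_assoc]
  rfl

end Channel

-- The joint density of randomness and messages

namespace SeqProtocol

variable {X Y : Type*} [MeasurableSpace X] [MeasurableSpace Y] {μ : Measure Y}
  {n : ℕ} {𝒲 : Fin n → Set (Channel X Y μ)} {U : Type*} [MeasurableSpace U]
  {V : Fin n → Type*} [∀ t, MeasurableSpace (V t)]

instance (Pr : SeqProtocol 𝒲 U V) : IsProbabilityMeasure Pr.pubLaw :=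
  Pr.isProbabilityMeasure_pubLaw

instance (Pr : SeqProtocol 𝒲 U V) (t : Fin n) : IsProbabilityMeasure (Pr.privLaw t) :=
  Pr.isProbabilityMeasure_privLaw t

/-- The channel used by player `t`, as a function of the whole randomness `ω`. -/
def channel (Pr : SeqProtocol 𝒲 U V) (t : Fin n) (ω : U × ∀ t, V t) (h : Fin t → Y) :
    Channel X Y μ :=
  Pr.select t ω.1 (ω.2 t) h

/-- The conditional density of the message of player `t` given the randomness and the previous
messages, when the samples have law `P`. -/
noncomputable def msgDensity (Pr : SeqProtocol 𝒲 U V) (P : Measure X) (t : Fin n) (ω : U × ∀ t, V t)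
    (h : Fin t → Y) (b : Y) : ℝ≥0 :=
  ((Pr.channel t ω h).outDensity P b).toNNReal

/-- The conditional density of the message of player `t`, as a function of the randomness and all
messages. -/
noncomputable def msgFactor (Pr : SeqProtocol 𝒲 U V) (P : Measure X) (t : Fin n)
    (θ : (U × ∀ t, V t) × (Fin n → Y)) : ℝ≥0 :=
  Pr.msgDensity P t θ.1 (history t θ.2) (θ.2 t)

/-- The law of the randomness times the reference measure for the messages. -/
noncomputable def refMeasure (Pr : SeqProtocol 𝒲 U V) : Measure ((U × ∀ t, V t) × (Fin n → Y)) :=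
  (Pr.pubLaw.prod (Measure.pi Pr.privLaw)).prod (Measure.pi fun _ => μ)

theorem measurable_condDensity (Pr : SeqProtocol 𝒲 U V) :
    Measurable fun q : U × (∀ t, V t) × (Fin n → X) × (Fin n → Y) =>
      Pr.condDensity q.1 q.2.1 q.2.2.1 q.2.2.2 := by
  unfold condDensity
  refine Finset.measurable_prod _ fun t _ => ?_
  have hm : Measurable fun q : U × (∀ t, V t) × (Fin n → X) × (Fin n → Y) =>
      (q.1, q.2.1 t, history t q.2.2.2, q.2.2.1 t, q.2.2.2 t) := by
    have := measurable_history (Y := Y) t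
    fun_prop
  exact ((Pr.measurable_select t).comp hm).coe_nnreal_ennreal

theorem measurable_msgDensity (Pr : SeqProtocol 𝒲 U V) (P : Measure X) [SFinite P] (t : Fin n) :
    Measurable fun r : (U × ∀ t, V t) × (Fin t → Y) × Y => Pr.msgDensity P t r.1 r.2.1 r.2.2 := by
  refine Measurable.ennreal_toNNReal ?_
  have hm : Measurable fun r : ((U × ∀ t, V t) × (Fin t → Y) × Y) × X =>
      (r.1.1.1, r.1.1.2 t, r.1.2.1, r.2, r.1.2.2) := by
    fun_prop
  exact ((Pr.measurable_select t).comp hm).coe_nnreal_ennreal.lintegral_prod_right'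

theorem measurable_uncurry_msgDensity (Pr : SeqProtocol 𝒲 U V) (P : Measure X) [SFinite P]
    (t : Fin n) (ω : U × ∀ t, V t) : Measurable (Function.uncurry (Pr.msgDensity P t ω)) :=
  (Pr.measurable_msgDensity P t).comp measurable_prodMk_left

theorem measurable_msgFactor (Pr : SeqProtocol 𝒲 U V) (P : Measure X) [SFinite P] (t : Fin n) :
    Measurable (Pr.msgFactor P t) := by
  have hm : Measurable fun θ : (U × ∀ t, V t) × (Fin n → Y) =>
      (θ.1, history t θ.2, θ.2 t) := by
    have := measurable_history (Y := Y) t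
    fun_prop
  exact (Pr.measurable_msgDensity P t).comp hm

theorem lintegral_condDensity (Pr : SeqProtocol 𝒲 U V) (P : Measure X) [IsProbabilityMeasure P]
    (u : U) (v : ∀ t, V t) (y : Fin n → Y) :
    ∫⁻ x, Pr.condDensity u v x y ∂(Measure.pi fun _ => P) =
      ∏ t, (Pr.channel t (u, v) (history t y)).outDensity P (y t) :=
  lintegral_pi_prod_eq (μ := P)
    (f := fun t x => ((Pr.channel t (u, v) (history t y)).density x (y t) : ℝ≥0∞))
    fun t => ((Pr.channel t (u, v) (history t y)).measurable_density_left (y t)).coe_nnreal_ennreal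

theorem measurable_prod_outDensity (Pr : SeqProtocol 𝒲 U V) (P : Measure X)
    [IsProbabilityMeasure P] (u : U) (v : ∀ t, V t) :
    Measurable fun y : Fin n → Y =>
      ∏ t, (Pr.channel t (u, v) (history t y)).outDensity P (y t) := by
  simp_rw [← lintegral_condDensity]
  exact (Pr.measurable_condDensity.comp (by fun_prop :
    Measurable fun r : (Fin n → Y) × (Fin n → X) => (u, v, r.2, r.1))).lintegral_prod_right'

variable [SigmaFinite μ]

theorem lintegral_msgDensity (Pr : SeqProtocol 𝒲 U V) (P : Measure X) [IsProbabilityMeasure P]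
    (t : Fin n) (ω : U × ∀ t, V t) (h : Fin t → Y) :
    ∫⁻ b, (Pr.msgDensity P t ω h b : ℝ≥0∞) ∂μ = 1 :=
  (Pr.channel t ω h).lintegral_toNNReal_outDensity P

theorem lintegral_prod_msgDensity (Pr : SeqProtocol 𝒲 U V) (P : Measure X)
    [IsProbabilityMeasure P] (ω : U × ∀ t, V t) :
    ∫⁻ y, ∏ t, (Pr.msgDensity P t ω (history t y) (y t) : ℝ≥0∞) ∂(Measure.pi fun _ => μ) = 1 := by
  rw [lintegral_prod_history_eq (g := fun t h b => (Pr.msgDensity P t ω h b : ℝ≥0∞))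
    (fun t => (Pr.measurable_uncurry_msgDensity P t ω).coe_nnreal_ennreal)
    (Pr.lintegral_msgDensity P · ω)]
  simp

theorem lintegral_hybridDensity_msgFactor (Pr : SeqProtocol 𝒲 U V) (P Q : Measure X)
    [IsProbabilityMeasure P] [IsProbabilityMeasure Q] (S : Finset (Fin n)) :
    ∫⁻ θ, (hybridDensity (Pr.msgFactor P) (Pr.msgFactor Q) S θ : ℝ≥0∞) ∂Pr.refMeasure = 1 := by
  rw [refMeasure, lintegral_prod _ (measurable_hybridDensity (Pr.measurable_msgFactor P)
    (Pr.measurable_msgFactor Q) S).coe_nnreal_ennreal.aemeasurable]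
  have h : ∀ ω : U × ∀ t, V t, ∫⁻ y, (hybridDensity (Pr.msgFactor P) (Pr.msgFactor Q) S (ω, y) :
      ℝ≥0∞) ∂(Measure.pi fun _ => μ) = 1 := by
    intro ω
    simp only [hybridDensity, ENNReal.ofNNReal_finsetProd]
    refine (lintegral_prod_history_eq (g := fun t h b =>
      ((if t ∈ S then Pr.msgDensity Q t ω h b else Pr.msgDensity P t ω h b : ℝ≥0) : ℝ≥0∞))
      (C := fun _ => 1) (fun t => ?_) fun t h => ?_).trans (by simp)
    · by_cases ht : t ∈ S
      · simpa only [ht, if_true, Function.uncurry_def] using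
          (Pr.measurable_uncurry_msgDensity Q t ω).coe_nnreal_ennreal
      · simpa only [ht, if_false, Function.uncurry_def] using
          (Pr.measurable_uncurry_msgDensity P t ω).coe_nnreal_ennreal
    · by_cases ht : t ∈ S
      · simpa only [ht, if_true] using Pr.lintegral_msgDensity Q t ω h
      · simpa only [ht, if_false] using Pr.lintegral_msgDensity P t ω h
  simp [h]

/-- The exceptional null set of each factor depends on the history, so equality is obtained by
comparing integrals: the left side is pointwise smaller and has integral one, while the right side
has integral at most one. -/
theorem prod_msgDensity_ae_eq (Pr : SeqProtocol 𝒲 U V) (P : Measure X) [IsProbabilityMeasure P]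
    (u : U) (v : ∀ t, V t) :
    (fun y : Fin n → Y => ∏ t, (Pr.msgDensity P t (u, v) (history t y) (y t) : ℝ≥0∞))
      =ᵐ[Measure.pi fun _ => μ]
      fun y => ∏ t, (Pr.channel t (u, v) (history t y)).outDensity P (y t) := by
  refine ae_eq_of_ae_le_of_lintegral_le
    (.of_forall fun y => Finset.prod_le_prod' fun t _ => ENNReal.coe_toNNReal_le_self)
    (by simp [lintegral_prod_msgDensity]) (Pr.measurable_prod_outDensity P u v).aemeasurable ?_
  rw [lintegral_prod_msgDensity]
  simp_rw [← lintegral_condDensity]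
  have hm : Measurable (Function.uncurry fun (y : Fin n → Y) (x : Fin n → X) =>
      Pr.condDensity u v x y) := Pr.measurable_condDensity.comp (by fun_prop :
    Measurable fun r : (Fin n → Y) × (Fin n → X) => (u, v, r.2, r.1))
  -- For fixed samples, the message density is itself a sequential product of channel densities.
  rw [lintegral_lintegral_swap hm.aemeasurable]
  refine (lintegral_mono fun x => ?_).trans 
    (by simp : ∫⁻ _ : Fin n → X, 1 ∂(Measure.pi fun _ => P) ≤ 1)
  refine (lintegral_prod_history_le (C := fun _ => 1)
    (g := fun t h b => ((Pr.channel t (u, v) h).density (x t) b : ℝ≥0∞)) (fun t => ?_)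
    fun t h => ((Pr.channel t (u, v) h).lintegral_density (x t)).le).trans (by simp)
  exact ((Pr.measurable_select t).comp (by fun_prop :
    Measurable fun r : (Fin t → Y) × Y => (u, v t, r.1, x t, r.2))).coe_nnreal_ennreal

/-- The joint law of randomness and messages has the product of the message densities as its
density. -/
theorem map_jointLaw (Pr : SeqProtocol 𝒲 U V) (P : Measure X) [IsProbabilityMeasure P] :
    (Pr.jointLaw P).map (fun q => ((q.1, q.2.1), q.2.2.2)) =
      Pr.refMeasure.withDensity fun θ => ∏ t, (Pr.msgFactor P t θ : ℝ≥0∞) := by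
  have hF : Measurable fun q : U × (∀ t, V t) × (Fin n → X) × (Fin n → Y) =>
      ((q.1, q.2.1), q.2.2.2) := by fun_prop
  have hD : Measurable fun θ => ∏ t, (Pr.msgFactor P t θ : ℝ≥0∞) :=
    Finset.measurable_prod _ fun t _ => (Pr.measurable_msgFactor P t).coe_nnreal_ennreal
  refine Measure.ext_of_lintegral _ fun g hg => ?_
  have hcg := Pr.measurable_condDensity.mul (hg.comp hF)
  have hDg := hD.mul hg
  rw [lintegral_map hg hF, jointLaw]
  refine (lintegral_withDensity_eq_lintegral_mul _ Pr.measurable_condDensity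
    (hg.comp hF)).trans ?_
  rw [lintegral_withDensity_eq_lintegral_mul _ hD hg, refMeasure,
    lintegral_prod _ hcg.aemeasurable, lintegral_prod _ hDg.aemeasurable,
    lintegral_prod _ hDg.lintegral_prod_right'.aemeasurable]
  refine lintegral_congr fun u => ?_
  have hcgu := hcg.comp (measurable_prodMk_left (x := u))
  refine (lintegral_prod _ hcgu.aemeasurable).trans (lintegral_congr fun v => ?_)
  have hcgv := hcgu.comp (measurable_prodMk_left (x := v))
  refine (lintegral_prod_symm' _ hcgv).trans (lintegral_congr_ae ?_)
  filter_upwards [Pr.prod_msgDensity_ae_eq P u v] with y hy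
  have hc : Measurable fun x => Pr.condDensity u v x y :=
    Pr.measurable_condDensity.comp (by fun_prop : Measurable fun x : Fin n → X => (u, v, x, y))
  simp only [Pi.mul_apply, Function.comp_apply]
  rw [lintegral_mul_const _ hc, lintegral_condDensity, ← hy]
  rfl

end SeqProtocol

-- Total variation and mixtures over the hypercube

section TotalVariation

variable {Ω : Type*} [MeasurableSpace Ω]

theorem tvDist_nonneg (P Q : Measure Ω) : 0 ≤ tvDist P Q :=
  Real.iSup_nonneg fun _ => abs_nonneg _

theorem tvDist_comm (P Q : Measure Ω) : tvDist P Q = tvDist Q P := by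
  simp_rw [tvDist, abs_sub_comm]

theorem tvDist_le {P Q : Measure Ω} {c : ℝ}
    (h : ∀ A, MeasurableSet A → |P.real A - Q.real A| ≤ c) : tvDist P Q ≤ c := by
  have : Nonempty {A : Set Ω // MeasurableSet A} := ⟨⟨∅, MeasurableSet.empty⟩⟩
  exact ciSup_le fun A => h A.1 A.2

theorem abs_real_sub_real_le_tvDist (P Q : Measure Ω) [IsProbabilityMeasure P]
    [IsProbabilityMeasure Q] {A : Set Ω} (hA : MeasurableSet A) :
    |P.real A - Q.real A| ≤ tvDist P Q := by
  refine le_ciSup (f := fun A : {A : Set Ω // MeasurableSet A} => |P.real A.1 - Q.real A.1|)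
    ⟨1, ?_⟩ ⟨A, hA⟩
  rintro _ ⟨B, rfl⟩
  have h1 := measureReal_le_one (μ := P) (s := B.1)
  have h2 := measureReal_le_one (μ := Q) (s := B.1)
  have h3 := measureReal_nonneg (μ := P) (s := B.1)
  have h4 := measureReal_nonneg (μ := Q) (s := B.1)
  exact abs_le.2 ⟨by linarith, by linarith⟩

theorem ofReal_tvDist_sq_le {P Q : Measure Ω} {c : ℝ≥0∞}
    (h : ∀ A, MeasurableSet A → ENNReal.ofReal ((P.real A - Q.real A) ^ 2) ≤ c) :
    ENNReal.ofReal (tvDist P Q ^ 2) ≤ c := by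
  rcases eq_or_ne c ∞ with rfl | hc
  · exact le_top
  rw [ENNReal.ofReal_le_iff_le_toReal hc]
  have h' : tvDist P Q ≤ √c.toReal := tvDist_le fun A hA =>
    Real.abs_le_sqrt ((ENNReal.ofReal_le_iff_le_toReal hc).1 (h A hA))
  calc tvDist P Q ^ 2 ≤ √c.toReal ^ 2 := pow_le_pow_left₀ (tvDist_nonneg P Q) h' 2
    _ = c.toReal := Real.sq_sqrt ENNReal.toReal_nonneg

end TotalVariation

theorem flipCoord_flipCoord {k : ℕ} (z : Fin k → ℤˣ) (i : Fin k) :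
    flipCoord (flipCoord z i) i = z := by
  simp [flipCoord]

theorem rademacher_singleton_one (τ : ℝ) : rademacher τ {1} = ENNReal.ofReal τ := by
  simp [rademacher, show (-1 : ℤˣ) ≠ 1 by decide]

theorem rademacher_singleton_neg_one (τ : ℝ) :
    rademacher τ {-1} = ENNReal.ofReal (1 - τ) := by
  simp [rademacher, show (1 : ℤˣ) ≠ -1 by decide]

theorem isProbabilityMeasure_rademacher {τ : ℝ} (h0 : 0 ≤ τ) (h1 : τ ≤ 1) :
    IsProbabilityMeasure (rademacher τ) := by
  refine ⟨?_⟩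
  simp only [rademacher, Measure.coe_add, Measure.coe_smul, Pi.add_apply, Pi.smul_apply,
    measure_univ, smul_eq_mul, mul_one]
  rw [← ENNReal.ofReal_add h0 (by linarith)]
  simp

/-- The probability of `z` under `Rad(τ)^{⊗ k}` conditioned on its `i`-th coordinate being `s`. -/
theorem cond_pi_rademacher_real_singleton {k : ℕ} {τ : ℝ} (h0 : 0 < τ) (h1 : τ < 1) (i : Fin k)
    (s : ℤˣ) (z : Fin k → ℤˣ) :
    (cond (Measure.pi fun _ : Fin k => rademacher τ) {z' | z' i = s}).real {z} =
      if z i = s then ∏ j ∈ Finset.univ.erase i, (rademacher τ).real {z j} else 0 := by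
  have := isProbabilityMeasure_rademacher h0.le h1.le
  have hms : MeasurableSet {z' : Fin k → ℤˣ | z' i = s} :=
    (measurableSet_singleton s).preimage (measurable_pi_apply i)
  rw [Measure.real, cond_apply hms, ENNReal.toReal_mul, ENNReal.toReal_inv, ← Measure.real,
    ← Measure.real]
  split_ifs with hz
  · have e1 : {z' : Fin k → ℤˣ | z' i = s} ∩ {z} = {z} := by
      rw [Set.inter_eq_right, Set.singleton_subset_iff]
      exact hz
    have e2 : (Measure.pi fun _ : Fin k => rademacher τ).real {z' | z' i = s} =
        (rademacher τ).real {s} := by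
      rw [Measure.real, Measure.real, ← (measurePreserving_eval (fun _ : Fin k => rademacher τ) i
        ).measure_preimage (measurableSet_singleton s).nullMeasurableSet]
      rfl
    have hs : (rademacher τ).real {s} ≠ 0 := by
      rcases Int.units_eq_one_or s with rfl | rfl
      · rw [Measure.real, rademacher_singleton_one, ENNReal.toReal_ofReal h0.le]
        exact h0.ne'
      · rw [Measure.real, rademacher_singleton_neg_one, ENNReal.toReal_ofReal (by linarith)]
        linarith
    rw [e1, e2, Measure.real, Measure.real, Measure.pi_singleton, ENNReal.toReal_prod,
      ← Finset.mul_prod_erase _ _ (Finset.mem_univ i), hz]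
    exact inv_mul_cancel_left₀ hs _
  · have e1 : {z' : Fin k → ℤˣ | z' i = s} ∩ {z} = ∅ := by
      rw [Set.inter_singleton_eq_empty]
      exact hz
    simp [e1]

/-- Conditioning removes the only biased weight that the flip would change, so the flip is a
bijection between the two conditional laws. -/
theorem cond_pi_rademacher_real_flipCoord {k : ℕ} {τ : ℝ} (h0 : 0 < τ) (h1 : τ < 1) (i : Fin k)
    (z : Fin k → ℤˣ) :
    (cond (Measure.pi fun _ : Fin k => rademacher τ) {z' | z' i = -1}).real {flipCoord z i} =
      (cond (Measure.pi fun _ : Fin k => rademacher τ) {z' | z' i = 1}).real {z} := by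
  rw [cond_pi_rademacher_real_singleton h0 h1, cond_pi_rademacher_real_singleton h0 h1]
  have e : flipCoord z i i = -1 ↔ z i = 1 := by simp [flipCoord]
  simp only [e]
  congr 1
  refine Finset.prod_congr rfl fun j hj => ?_
  rw [flipCoord, Function.update_of_ne (Finset.ne_of_mem_erase hj)]

theorem pi_rademacher_real_singleton {k : ℕ} {τ : ℝ} (h0 : 0 < τ) (h1 : τ < 1) (i : Fin k)
    (z : Fin k → ℤˣ) :
    (Measure.pi fun _ : Fin k => rademacher τ).real {z} =
      τ * (cond (Measure.pi fun _ : Fin k => rademacher τ) {z' | z' i = 1}).real {z} +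
      (1 - τ) * (cond (Measure.pi fun _ : Fin k => rademacher τ) {z' | z' i = -1}).real {z} := by
  have := isProbabilityMeasure_rademacher h0.le h1.le
  rw [cond_pi_rademacher_real_singleton h0 h1, cond_pi_rademacher_real_singleton h0 h1,
    Measure.real, Measure.pi_singleton, ENNReal.toReal_prod,
    ← Finset.mul_prod_erase _ _ (Finset.mem_univ i)]
  rcases Int.units_eq_one_or (z i) with h | h
  · simp [h, rademacher_singleton_one, ENNReal.toReal_ofReal h0.le, Measure.real,
      show (1 : ℤˣ) ≠ -1 by decide]
  · simp [h, rademacher_singleton_neg_one, ENNReal.toReal_ofReal (by linarith : 0 ≤ 1 - τ),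
      Measure.real, show (-1 : ℤˣ) ≠ 1 by decide]

theorem condMixture_real_apply {k : ℕ} {Ω : Type*} [MeasurableSpace Ω] (τ : ℝ)
    (Q : (Fin k → ℤˣ) → Measure Ω) [∀ z, IsProbabilityMeasure (Q z)] (i : Fin k) (s : ℤˣ)
    (A : Set Ω) :
    (condMixture τ Q i s).real A = ∑ z, (cond (Measure.pi fun _ : Fin k => rademacher τ)
      {z' | z' i = s}).real {z} * (Q z).real A := by
  simp only [condMixture, Measure.real, Measure.coe_finsetSum, Finset.sum_apply,
    Measure.coe_smul, Pi.smul_apply, smul_eq_mul]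
  rw [ENNReal.toReal_sum fun z _ => ENNReal.mul_ne_top (measure_ne_top _ _) (measure_ne_top _ _)]
  simp

/-- The total variation distance of the two conditional mixtures is at most the average distance
of the laws of neighbouring parameters. -/
theorem tvDist_condMixture_le {k : ℕ} {Ω : Type*} [MeasurableSpace Ω] {τ : ℝ} (h0 : 0 < τ)
    (h1 : τ < 1) (Q : (Fin k → ℤˣ) → Measure Ω) [∀ z, IsProbabilityMeasure (Q z)] (i : Fin k) :
    tvDist (condMixture τ Q i 1) (condMixture τ Q i (-1)) ≤
      ∑ z, (Measure.pi fun _ : Fin k => rademacher τ).real {z} *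
        tvDist (Q z) (Q (flipCoord z i)) := by
  set w : ℤˣ → (Fin k → ℤˣ) → ℝ := fun s z =>
    (cond (Measure.pi fun _ : Fin k => rademacher τ) {z' | z' i = s}).real {z} with hw
  let e : (Fin k → ℤˣ) ≃ (Fin k → ℤˣ) :=
    Function.Involutive.toPerm (fun z => flipCoord z i) fun z => flipCoord_flipCoord z i
  have hflip : ∀ F : (Fin k → ℤˣ) → ℝ, ∑ z, w (-1) z * F z = ∑ z, w 1 z * F (flipCoord z i) :=
    fun F => (Fintype.sum_equiv e _ _ fun z => by
      exact congrArg (· * _) (cond_pi_rademacher_real_flipCoord h0 h1 i z).symm).symm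
  have hsum : ∑ z, (Measure.pi fun _ : Fin k => rademacher τ).real {z} *
      tvDist (Q z) (Q (flipCoord z i)) = ∑ z, w 1 z * tvDist (Q z) (Q (flipCoord z i)) := by
    -- The law of `Z` is the `τ`, `1 - τ` mixture of the two conditional laws. Both give the same
    -- average, because the distance within a pair is symmetric under the flip.
    simp_rw [pi_rademacher_real_singleton h0 h1 i, add_mul, mul_assoc, Finset.sum_add_distrib,
      ← Finset.mul_sum]
    have := hflip fun z => tvDist (Q z) (Q (flipCoord z i))
    simp only [hw] at this
    simp_rw [flipCoord_flipCoord] at this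
    rw [this]
    simp_rw [hw, tvDist_comm (Q (flipCoord _ i))]
    ring
  rw [hsum]
  refine tvDist_le fun A hA => ?_
  rw [condMixture_real_apply, condMixture_real_apply]
  have := hflip fun z => (Q z).real A
  simp only [hw] at this
  rw [this, ← Finset.sum_sub_distrib]
  refine (Finset.abs_sum_le_sum_abs _ _).trans (Finset.sum_le_sum fun z _ => ?_)
  rw [← mul_sub, abs_mul, abs_of_nonneg measureReal_nonneg]
  exact mul_le_mul_of_nonneg_left (abs_real_sub_real_le_tvDist _ _ hA) measureReal_nonneg

/-- Cauchy–Schwarz over `z` (weights of total mass one) and over `i` (giving `1 / k`) moves the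
square inside. Exchanging the sums leaves, for each `z`, the sum over `i` that `h` bounds. -/
theorem ofReal_mean_tvDist_condMixture_sq_le {k : ℕ} (hk : 1 ≤ k) {Ω : Type*}
    [MeasurableSpace Ω] {τ : ℝ} (h0 : 0 < τ) (h1 : τ < 1) (Q : (Fin k → ℤˣ) → Measure Ω)
    [∀ z, IsProbabilityMeasure (Q z)] {c : ℝ≥0∞}
    (h : ∀ z, ∑ i, ENNReal.ofReal (tvDist (Q z) (Q (flipCoord z i)) ^ 2) ≤ c) :
    ENNReal.ofReal ((1 / (k : ℝ) * ∑ i : Fin k,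
      tvDist (condMixture τ Q i 1) (condMixture τ Q i (-1))) ^ 2) ≤
      ENNReal.ofReal (1 / k) * c := by
  have := isProbabilityMeasure_rademacher h0.le h1.le
  set w : (Fin k → ℤˣ) → ℝ := fun z => (Measure.pi fun _ : Fin k => rademacher τ).real {z} with hw
  have hw0 : ∀ z, 0 ≤ w z := fun z => measureReal_nonneg
  have hw1 : ∑ z, w z = 1 := by
    rw [hw, sum_measureReal_singleton]
    simp
  have hk0 : (0 : ℝ) < k := by exact_mod_cast hk
  have hz : ∀ i : Fin k, tvDist (condMixture τ Q i 1) (condMixture τ Q i (-1)) ^ 2 ≤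
      ∑ z, w z * tvDist (Q z) (Q (flipCoord z i)) ^ 2 := by
    intro i
    refine (pow_le_pow_left₀ (tvDist_nonneg _ _) (tvDist_condMixture_le h0 h1 Q i) 2).trans ?_
    refine (Finset.sum_sq_le_sum_mul_sum_of_sq_le_mul Finset.univ (f := w)
      (g := fun z => w z * tvDist (Q z) (Q (flipCoord z i)) ^ 2) (fun z _ => hw0 z)
      (fun z _ => mul_nonneg (hw0 z) (sq_nonneg _)) fun z _ =>
        le_of_eq (by ring)).trans ?_
    rw [hw1, one_mul]
  have hi : (1 / (k : ℝ) * ∑ i : Fin k,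
      tvDist (condMixture τ Q i 1) (condMixture τ Q i (-1))) ^ 2 ≤
      1 / k * ∑ z, w z * ∑ i, tvDist (Q z) (Q (flipCoord z i)) ^ 2 := by
    have hc := sq_sum_le_card_mul_sum_sq (s := (Finset.univ : Finset (Fin k)))
      (f := fun i => tvDist (condMixture τ Q i 1) (condMixture τ Q i (-1)))
    rw [Finset.card_univ, Fintype.card_fin] at hc
    have hs := Finset.sum_le_sum fun (i : Fin k) (_ : i ∈ Finset.univ) => hz i
    rw [Finset.sum_comm] at hs
    simp_rw [← Finset.mul_sum] at hs
    calc _ = (1 / (k : ℝ)) ^ 2 * _ := mul_pow _ _ _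
      _ ≤ (1 / (k : ℝ)) ^ 2 * (k * ∑ z, w z * ∑ i, tvDist (Q z) (Q (flipCoord z i)) ^ 2) := by
        gcongr
        exact hc.trans (by gcongr)
      _ = _ := by field_simp
  refine (ENNReal.ofReal_le_ofReal hi).trans ?_
  rw [ENNReal.ofReal_mul (by positivity)]
  gcongr
  rw [ENNReal.ofReal_sum_of_nonneg fun z _ =>
    mul_nonneg (hw0 z) (Finset.sum_nonneg fun i _ => sq_nonneg _)]
  calc _ ≤ ∑ z, ENNReal.ofReal (w z) * c := by
        refine Finset.sum_le_sum fun z _ => ?_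
        rw [ENNReal.ofReal_mul (hw0 z), ENNReal.ofReal_sum_of_nonneg fun i _ => sq_nonneg _]
        gcongr
        exact h z
    _ = c := by
        rw [← Finset.sum_mul, ← ENNReal.ofReal_sum_of_nonneg fun z _ => hw0 z, hw1,
          ENNReal.ofReal_one, one_mul]

-- Information contraction for protocols

namespace SeqProtocol

variable {X Y : Type*} [MeasurableSpace X] [MeasurableSpace Y] {μ : Measure Y}
  {n : ℕ} {𝒲 : Fin n → Set (Channel X Y μ)} {U : Type*} [MeasurableSpace U]
  {V : Fin n → Type*} [∀ t, MeasurableSpace (V t)]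

/-- The law of the randomness and the messages. -/
noncomputable def randMsgLaw (Pr : SeqProtocol 𝒲 U V) (P : Measure X) :
    Measure ((U × ∀ t, V t) × (Fin n → Y)) :=
  (Pr.jointLaw P).map fun q => ((q.1, q.2.1), q.2.2.2)

theorem messageLaw_eq_map (Pr : SeqProtocol 𝒲 U V) (P : Measure X) :
    Pr.messageLaw P = (Pr.randMsgLaw P).map Prod.snd := by
  rw [messageLaw, randMsgLaw, Measure.map_map measurable_snd (by fun_prop)]
  rfl

theorem transcriptLaw_eq_map (Pr : SeqProtocol 𝒲 U V) (P : Measure X) :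
    Pr.transcriptLaw P = (Pr.randMsgLaw P).map fun θ => (θ.2, θ.1.1) := by
  rw [transcriptLaw, randMsgLaw, Measure.map_map (by fun_prop) (by fun_prop)]
  rfl

/-- The integrand of the `χ²`-divergence between the messages of player `t` for the sample laws
`P` and `Q`. -/
noncomputable def chiSqIntegrand (Pr : SeqProtocol 𝒲 U V) (P Q : Measure X) (t : Fin n)
    (ω : U × ∀ t, V t) (h : Fin t → Y) (b : Y) : ℝ≥0∞ :=
  ENNReal.ofReal (((Pr.msgDensity Q t ω h b : ℝ) - Pr.msgDensity P t ω h b) ^ 2) /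
    Pr.msgDensity P t ω h b

theorem measurable_chiSqIntegrand (Pr : SeqProtocol 𝒲 U V) (P Q : Measure X) [SFinite P]
    [SFinite Q] (t : Fin n) :
    Measurable fun r : (U × ∀ t, V t) × (Fin t → Y) × Y =>
      Pr.chiSqIntegrand P Q t r.1 r.2.1 r.2.2 := by
  have hP := Pr.measurable_msgDensity P t
  have hQ := Pr.measurable_msgDensity Q t
  exact ((hQ.coe_nnreal_real.sub hP.coe_nnreal_real).pow_const 2).ennreal_ofReal.div
    hP.coe_nnreal_ennreal

theorem measurable_chiSqIntegrand_right (Pr : SeqProtocol 𝒲 U V) (P Q : Measure X) [SFinite P]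
    [SFinite Q] (t : Fin n) (ω : U × ∀ t, V t) (h : Fin t → Y) :
    Measurable (Pr.chiSqIntegrand P Q t ω h) := by
  have hP : Measurable (Pr.msgDensity P t ω h) :=
    (Pr.measurable_uncurry_msgDensity P t ω).comp measurable_prodMk_left
  have hQ : Measurable (Pr.msgDensity Q t ω h) :=
    (Pr.measurable_uncurry_msgDensity Q t ω).comp measurable_prodMk_left
  exact ((hQ.coe_nnreal_real.sub hP.coe_nnreal_real).pow_const 2).ennreal_ofReal.div
    hP.coe_nnreal_ennreal

theorem measurable_chiSqIntegrand_history (Pr : SeqProtocol 𝒲 U V) (P Q : Measure X) [SFinite P]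
    [SFinite Q] (t : Fin n) : Measurable fun θ : (U × ∀ t, V t) × (Fin n → Y) =>
      Pr.chiSqIntegrand P Q t θ.1 (history t θ.2) (θ.2 t) := by
  have hP := Pr.measurable_msgFactor P t
  have hQ := Pr.measurable_msgFactor Q t
  exact ((hQ.coe_nnreal_real.sub hP.coe_nnreal_real).pow_const 2).ennreal_ofReal.div
    hP.coe_nnreal_ennreal

variable [SigmaFinite μ]

instance (Pr : SeqProtocol 𝒲 U V) (P : Measure X) [IsProbabilityMeasure P] :
    IsProbabilityMeasure (Pr.randMsgLaw P) := by
  refine ⟨?_⟩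
  rw [randMsgLaw, map_jointLaw, withDensity_apply _ MeasurableSet.univ, Measure.restrict_univ]
  simpa [hybridDensity] using Pr.lintegral_hybridDensity_msgFactor P P ∅

instance (Pr : SeqProtocol 𝒲 U V) (P : Measure X) [IsProbabilityMeasure P] :
    IsProbabilityMeasure (Pr.messageLaw P) := by
  rw [messageLaw_eq_map]
  exact Measure.isProbabilityMeasure_map measurable_snd.aemeasurable

instance (Pr : SeqProtocol 𝒲 U V) (P : Measure X) [IsProbabilityMeasure P] :
    IsProbabilityMeasure (Pr.transcriptLaw P) := by
  rw [transcriptLaw_eq_map]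
  exact Measure.isProbabilityMeasure_map (by fun_prop)

/-- Replacing the factor of player `t` in the density of the messages by a function whose
conditional integral is at most `c` gives an integral of at most `c`. -/
theorem lintegral_replace_msgFactor_le (Pr : SeqProtocol 𝒲 U V) (P : Measure X)
    [IsProbabilityMeasure P] (t : Fin n)
    {g : ∀ s : Fin n, (U × ∀ t, V t) → (Fin s → Y) → Y → ℝ≥0∞}
    (hg : ∀ s : Fin n, Measurable fun r : (U × ∀ t, V t) × (Fin s → Y) × Y => g s r.1 r.2.1 r.2.2)
    {c : ℝ≥0∞} (hc : ∀ ω h, ∫⁻ b, g t ω h b ∂μ ≤ c) :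
    ∫⁻ θ, ∏ s, (if s = t then g s θ.1 (history s θ.2) (θ.2 s) else (Pr.msgFactor P s θ : ℝ≥0∞))
      ∂Pr.refMeasure ≤ c := by
  have hm : Measurable fun θ : (U × ∀ t, V t) × (Fin n → Y) =>
      ∏ s, (if s = t then g s θ.1 (history s θ.2) (θ.2 s)
        else (Pr.msgFactor P s θ : ℝ≥0∞)) := by
    refine Finset.measurable_prod _ fun s _ => ?_
    split_ifs
    · have := measurable_history (Y := Y) s
      exact (hg s).comp (by fun_prop : Measurable fun θ : (U × ∀ t, V t) × (Fin n → Y) =>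
        (θ.1, history s θ.2, θ.2 s))
    · exact (Pr.measurable_msgFactor P s).coe_nnreal_ennreal
  rw [refMeasure, lintegral_prod _ hm.aemeasurable]
  refine (lintegral_mono fun ω => ?_).trans
    (by simp : ∫⁻ _, c ∂(Pr.pubLaw.prod (Measure.pi Pr.privLaw)) ≤ c)
  refine (lintegral_prod_history_le (g := fun s h b =>
      if s = t then g s ω h b else (Pr.msgDensity P s ω h b : ℝ≥0∞))
    (C := fun s => if s = t then c else 1) (fun s => ?_) fun s h => ?_).trans (by simp)
  · by_cases hs : s = t
    · have h : Measurable fun r : (Fin s → Y) × Y => g s ω r.1 r.2 :=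
        (hg s).comp measurable_prodMk_left
      simpa only [hs, if_true, Function.uncurry_def] using h
    · simpa only [hs, if_false, Function.uncurry_def] using
        (Pr.measurable_uncurry_msgDensity P s ω).coe_nnreal_ennreal
  · by_cases hs : s = t
    · subst hs
      simpa using hc ω h
    · simpa only [hs, if_false] using (Pr.lintegral_msgDensity P s ω h).le

theorem ofReal_tvDist_map_randMsgLaw_sq_le (Pr : SeqProtocol 𝒲 U V) (P Q : Measure X)
    [IsProbabilityMeasure P] [IsProbabilityMeasure Q] {T : Type*} [MeasurableSpace T]
    {F : (U × ∀ t, V t) × (Fin n → Y) → T} (hF : Measurable F) :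
    ENNReal.ofReal (tvDist ((Pr.randMsgLaw P).map F) ((Pr.randMsgLaw Q).map F) ^ 2) ≤
      4 * ∑ t, ∫⁻ θ, ∏ s, (if s = t then Pr.chiSqIntegrand P Q s θ.1 (history s θ.2) (θ.2 s)
        else (Pr.msgFactor P s θ : ℝ≥0∞)) ∂Pr.refMeasure := by
  refine ofReal_tvDist_sq_le fun A hA => ?_
  rw [map_measureReal_apply hF hA, map_measureReal_apply hF hA, randMsgLaw, randMsgLaw,
    map_jointLaw, map_jointLaw]
  refine (ofReal_withDensity_sub_sq_le (Pr.measurable_msgFactor P) (Pr.measurable_msgFactor Q)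
    (Pr.lintegral_hybridDensity_msgFactor P Q) (hF hA)).trans (le_of_eq ?_)
  congr 1
  refine Finset.sum_congr rfl fun t _ => lintegral_congr fun θ => Finset.prod_congr rfl fun s _ => ?_
  split_ifs with hs
  · subst hs
    rfl
  · rfl

/-- Information contraction for a fixed sample law `P` and finitely many perturbations of it. -/
theorem sum_ofReal_tvDist_map_randMsgLaw_sq_le (Pr : SeqProtocol 𝒲 U V) {κ : Type*} [Fintype κ]
    (P : Measure X) [IsProbabilityMeasure P] (Q : κ → Measure X) [∀ i, IsProbabilityMeasure (Q i)]
    (hQP : ∀ i, Q i ≪ P) {α : ℝ} {a : κ → ℝ} (ha : ∀ i, |a i| ≤ α) {φ : κ → X → ℝ}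
    (hdens : ∀ i, (fun x => ((Q i).rnDeriv P x).toReal) =ᵐ[P] fun x => 1 + a i * φ i x)
    {T : Type*} [MeasurableSpace T] {F : (U × ∀ t, V t) × (Fin n → Y) → T} (hF : Measurable F) :
    ∑ i, ENNReal.ofReal (tvDist ((Pr.randMsgLaw P).map F) ((Pr.randMsgLaw (Q i)).map F) ^ 2) ≤
      4 * (ENNReal.ofReal (α ^ 2) * ∑ t, ⨆ W ∈ 𝒲 t, ∑ i, W.info P (φ i)) := by
  -- For fixed randomness and history, all `i` share one channel, so the supremum is taken of the
  -- sum rather than of each term.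
  have hchi : ∀ (t : Fin n) (ω : U × ∀ t, V t) (h : Fin t → Y),
      ∫⁻ b, ∑ i, Pr.chiSqIntegrand P (Q i) t ω h b ∂μ ≤
        ENNReal.ofReal (α ^ 2) * ⨆ W ∈ 𝒲 t, ∑ i, W.info P (φ i) := by
    intro t ω h
    rw [lintegral_finsetSum _ fun i _ => Pr.measurable_chiSqIntegrand_right P (Q i) t ω h]
    calc _ ≤ ∑ i, ENNReal.ofReal (α ^ 2) * (Pr.channel t ω h).info P (φ i) := by
          refine Finset.sum_le_sum fun i _ => ?_
          refine ((Pr.channel t ω h).lintegral_outDensity_sub_sq_div_le (hQP i)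
            (hdens i)).trans ?_
          gcongr ENNReal.ofReal ?_ * _
          exact sq_le_sq' (abs_le.1 (ha i)).1 (abs_le.1 (ha i)).2
      _ ≤ _ := by
          rw [← Finset.mul_sum]
          gcongr
          exact le_iSup₂ (f := fun W (_ : W ∈ 𝒲 t) => ∑ i, W.info P (φ i))
            (Pr.channel t ω h) (Pr.select_mem t ω.1 (ω.2 t) h)
  have hsum : ∀ s : Fin n, Measurable fun r : (U × ∀ t, V t) × (Fin s → Y) × Y =>
      ∑ i, Pr.chiSqIntegrand P (Q i) s r.1 r.2.1 r.2.2 := by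
    intro s
    refine Finset.measurable_sum _ fun i _ => ?_
    exact Pr.measurable_chiSqIntegrand P (Q i) s
  have hmeas : ∀ (i : κ) (t s : Fin n), Measurable fun θ : (U × ∀ t, V t) × (Fin n → Y) =>
      if s = t then Pr.chiSqIntegrand P (Q i) s θ.1 (history s θ.2) (θ.2 s)
        else (Pr.msgFactor P s θ : ℝ≥0∞) := by
    intro i t s
    split_ifs
    · exact Pr.measurable_chiSqIntegrand_history P (Q i) s
    · exact (Pr.measurable_msgFactor P s).coe_nnreal_ennreal
  refine (Finset.sum_le_sum fun i _ =>
    Pr.ofReal_tvDist_map_randMsgLaw_sq_le P (Q i) hF).trans ?_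
  rw [← Finset.mul_sum, Finset.sum_comm, Finset.mul_sum _ _ (ENNReal.ofReal (α ^ 2))]
  gcongr with t
  rw [← lintegral_finsetSum _ fun i _ => Finset.measurable_prod _ fun s _ => hmeas i t s]
  refine le_trans (le_of_eq (lintegral_congr fun θ => ?_)) (Pr.lintegral_replace_msgFactor_le P t
    (g := fun s ω h b => ∑ i, Pr.chiSqIntegrand P (Q i) s ω h b)
    hsum (hchi t))
  -- Only the factor of round `t` depends on `i`, so the sum over `i` can be moved into it.
  rw [← Finset.mul_prod_erase _ _ (Finset.mem_univ t), if_pos rfl, Finset.sum_mul]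
  refine Finset.sum_congr rfl fun i _ => ?_
  rw [← Finset.mul_prod_erase _ _ (Finset.mem_univ t), if_pos rfl]
  congr 1
  exact Finset.prod_congr rfl fun s hs => by
    rw [if_neg (Finset.ne_of_mem_erase hs), if_neg (Finset.ne_of_mem_erase hs)]

/-- Information contraction for the image of the randomness and the messages under any map. -/
theorem ofReal_mean_tvDist_condMixture_map_sq_le (Pr : SeqProtocol 𝒲 U V) {k : ℕ} (hk : 1 ≤ k)
    {τ : ℝ} (hτ : 0 < τ) (hτ' : τ < 1) (p : (Fin k → ℤˣ) → Measure X)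
    [∀ z, IsProbabilityMeasure (p z)] {α : ℝ} {a : (Fin k → ℤˣ) → Fin k → ℝ}
    {φ : (Fin k → ℤˣ) → Fin k → X → ℝ} (ha : ∀ z i, |a z i| ≤ α)
    (hac : ∀ z i, p (flipCoord z i) ≪ p z)
    (hdens : ∀ z i, (fun x => ((p (flipCoord z i)).rnDeriv (p z) x).toReal) =ᵐ[p z]
      fun x => 1 + a z i * φ z i x)
    {T : Type*} [MeasurableSpace T] {F : (U × ∀ t, V t) × (Fin n → Y) → T} (hF : Measurable F) :
    ENNReal.ofReal ((1 / (k : ℝ) * ∑ i : Fin k,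
        tvDist (condMixture τ (fun z => (Pr.randMsgLaw (p z)).map F) i 1)
          (condMixture τ (fun z => (Pr.randMsgLaw (p z)).map F) i (-1))) ^ 2) ≤
      ENNReal.ofReal (7 / (k : ℝ) * α ^ 2) *
        ∑ t : Fin n, ⨆ z : Fin k → ℤˣ, ⨆ W ∈ 𝒲 t, ∑ i : Fin k, W.info (p z) (φ z i) := by
  have := fun z => Measure.isProbabilityMeasure_map (μ := Pr.randMsgLaw (p z)) hF.aemeasurable
  refine (ofReal_mean_tvDist_condMixture_sq_le hk hτ hτ' _ fun z =>
    (Pr.sum_ofReal_tvDist_map_randMsgLaw_sq_le (p z) (fun i => p (flipCoord z i)) (hac z) (ha z)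
      (hdens z) hF).trans (mul_le_mul_right (mul_le_mul_right (Finset.sum_le_sum fun t _ =>
        le_iSup (fun z => ⨆ W ∈ 𝒲 t, ∑ i : Fin k, W.info (p z) (φ z i)) z) _) _)).trans ?_
  rw [← mul_assoc, ← mul_assoc]
  gcongr
  rw [← ENNReal.ofReal_ofNat 4, ← ENNReal.ofReal_mul (by positivity),
    ← ENNReal.ofReal_mul (by positivity)]
  -- The argument yields the constant `4`, from `hybridConst M ≥ 1 / 4`, which is at most `7`.
  refine ENNReal.ofReal_le_ofReal (mul_le_mul_of_nonneg_right ?_ (sq_nonneg α))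
  rw [div_mul_eq_mul_div, one_mul]
  gcongr
  norm_num

end SeqProtocol

theorem mainTheorem1
    {X Y : Type*} [MeasurableSpace X] [MeasurableSpace Y] (μ : Measure Y) [SigmaFinite μ]
    (n k : ℕ) (hk : 1 ≤ k)
    (τ : ℝ) (hτ : 0 < τ) (hτ' : τ ≤ 1 / 2)
    (p : (Fin k → ℤˣ) → Measure X) [∀ z, IsProbabilityMeasure (p z)]
    (α : ℝ) (a : (Fin k → ℤˣ) → Fin k → ℝ) (φ : (Fin k → ℤˣ) → Fin k → X → ℝ)
    (hφ : ∀ z i, Measurable (φ z i))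
    (ha : ∀ z i, |a z i| ≤ α)
    (hac : ∀ z i, p (flipCoord z i) ≪ p z)
    (hdens : ∀ z i, (fun x => ((p (flipCoord z i)).rnDeriv (p z) x).toReal) =ᵐ[p z]
      fun x => 1 + a z i * φ z i x)
    (𝒲 : Fin n → Set (Channel X Y μ))
    {U : Type*} [MeasurableSpace U] {V : Fin n → Type*} [∀ t, MeasurableSpace (V t)]
    (Pr : SeqProtocol 𝒲 U V) :
    ENNReal.ofReal ((1 / (k : ℝ) * ∑ i : Fin k,
        tvDist (condMixture τ (fun z => Pr.messageLaw (p z)) i 1)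
          (condMixture τ (fun z => Pr.messageLaw (p z)) i (-1))) ^ 2) ≤
      ENNReal.ofReal (7 / (k : ℝ) * α ^ 2) *
        ∑ t : Fin n, ⨆ z : Fin k → ℤˣ, ⨆ W ∈ 𝒲 t, ∑ i : Fin k, W.info (p z) (φ z i) ∧
    ENNReal.ofReal ((1 / (k : ℝ) * ∑ i : Fin k,
        tvDist (condMixture τ (fun z => Pr.transcriptLaw (p z)) i 1)
          (condMixture τ (fun z => Pr.transcriptLaw (p z)) i (-1))) ^ 2) ≤
      ENNReal.ofReal (7 / (k : ℝ) * α ^ 2) *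
        ∑ t : Fin n, ⨆ z : Fin k → ℤˣ, ⨆ W ∈ 𝒲 t, ∑ i : Fin k, W.info (p z) (φ z i) := by
  simp_rw [SeqProtocol.messageLaw_eq_map, SeqProtocol.transcriptLaw_eq_map]
  have hτ1 : τ < 1 := by linarith
  exact ⟨Pr.ofReal_mean_tvDist_condMixture_map_sq_le hk hτ hτ1 p ha hac hdens measurable_snd,
    Pr.ofReal_mean_tvDist_condMixture_map_sq_le hk hτ hτ1 p ha hac hdens (by fun_prop)⟩
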